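/- Let $k$ be a field of characteristic $0$ and let $P=k((x_1))\cdots((x_n))((\partial_1^{-1}))\cdots((\partial_n^{-1}))$ be the ring of formal pseudo-differential operators in $n$ variables, with the multiplication given by the Leibniz rule. For $L\in P$ let $\mathrm{res}_P(L)$ be the coefficient of $L$ at $x_1^{-1}\cdots x_n^{-1}\partial_1^{-1}\cdots\partial_n^{-1}$, and let $L=L_++L_-$, where $L_+$ contains only the powers $\ge 0$ and $L_-$ only the powers $<0$ of $\partial_n$. On $P^n$ put $\langle L,M\rangle=\sum_i\mathrm{res}_P(L_iM_i)$ and $[X,Y]_R=\frac12[RX,Y]+\frac12[X,RY]$ (componentwise), where $RX=X_+-X_-$. Let $\mathcal F(P^n)$ be the space of functions on $P^n$ that are polynomial in any number of coefficients of the operators $L_1,\dots,L_n$: such a function is given by a possibly infinite sum of monomials of bounded degree in these coefficients, of which only finitely many are nonzero at each point. The gradient $\nabla_F(L)\in P^n$ is defined by $\langle M,\nabla_F(L)\rangle=\frac{d}{d\varepsilon}F(L+\varepsilon M)|_{\varepsilon=0}$ for all $M\in P^n$, and $\{F,G\}_R(L)=\langle L,[\nabla_F(L),\nabla_G(L)]_R\rangle$.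 For a multi-index $m=(m_1,\dots,m_n)$ of nonnegative integers let $H_m(L)=\mathrm{res}_P(L_1^{m_1}\cdots L_n^{m_n})$, and let $P'\subset P^n$ be the set of all $L$ with $[L_i,L_j]=0$ for all $i,j$. Then $H_m\in\mathcal F(P^n)$, every $F\in\mathcal F(P^n)$ has a unique gradient at every point of $P^n$, and the Hamiltonian system $$\frac{\partial F}{\partial t_m}=\{F,H_m\}_R,\qquad F\in\mathcal F(P^n),$$ has on $P'$ the form $$\frac{\partial L_i}{\partial t_m}=m_i\,\bigl[(L_1^{m_1}\cdots L_{i-1}^{m_{i-1}}L_i^{m_i-1}L_{i+1}^{m_{i+1}}\cdots L_n^{m_n})_+,\,L_i\bigr],\qquad i=1,\dots,n$$ (where the right-hand side is $0$ if $m_i=0$). That is, for $L\in P'$ and a tangent vector $X=\partial L/\partial t_m\in T_L=P^n$, the derivative of every $F\in\mathcal F(P^n)$ at $L$ along $X$ is $\{F,H_m\}_R(L)$ if and only if $X_i$ is this right-hand side for all $i$. -/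

import Mathlib

noncomputable section

/-- The exponents `(i, j)` of the monomials
`x₁ ^ i₁ ⋯ xₙ ^ iₙ ∂₁ ^ j₁ ⋯ ∂ₙ ^ jₙ`, with integers `iₛ` and `jₛ`. -/
def Exponent (n : ℕ) : Type := (Fin n → ℤ) × (Fin n → ℤ)

namespace Exponent

variable {n : ℕ}

/-- The exponents of `x₁, …, xₙ`. -/
def x (e : Exponent n) : Fin n → ℤ := e.1

/-- The exponents of `∂₁, …, ∂ₙ`. -/
def d (e : Exponent n) : Fin n → ℤ := e.2

instance : AddCommGroup (Exponent n) := inferInstanceAs (AddCommGroup ((Fin n → ℤ) × (Fin n → ℤ)))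

theorem ext {e f : Exponent n} (hx : e.x = f.x) (hd : e.d = f.d) : e = f := Prod.ext hx hd

@[simp] theorem x_add (e f : Exponent n) : (e + f).x = e.x + f.x := rfl
@[simp] theorem d_add (e f : Exponent n) : (e + f).d = e.d + f.d := rfl
@[simp] theorem x_sub (e f : Exponent n) : (e - f).x = e.x - f.x := rfl
@[simp] theorem d_sub (e f : Exponent n) : (e - f).d = e.d - f.d := rfl
@[simp] theorem x_neg (e : Exponent n) : (-e).x = -e.x := rfl
@[simp] theorem d_neg (e : Exponent n) : (-e).d = -e.d := rfl
@[simp] theorem x_zero : (0 : Exponent n).x = 0 := rfl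
@[simp] theorem d_zero : (0 : Exponent n).d = 0 := rfl

/-- The list of exponents with respect to `∂ₙ⁻¹, …, ∂₁⁻¹, xₙ, …, x₁`, in this order, ordered
lexicographically: the exponent of `∂ₙ⁻¹` is the most significant one and the exponent of `x₁` is
the least significant one. -/
def key (e : Exponent n) : Lex ((Fin n)ᵒᵈ → ℤ) ×ₗ Lex ((Fin n)ᵒᵈ → ℤ) :=
  toLex (toLex fun s => -e.d (OrderDual.ofDual s), toLex fun s => e.x (OrderDual.ofDual s))

theorem key_injective : Function.Injective (key (n := n)) := by
  intro e f h
  have h' := toLex.injective h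
  have h1 := toLex.injective (congrArg Prod.fst h')
  have h2 := toLex.injective (congrArg Prod.snd h')
  refine Exponent.ext (funext fun s => ?_) (funext fun s => ?_)
  · exact congrFun h2 (OrderDual.toDual s)
  · exact neg_injective (congrFun h1 (OrderDual.toDual s))

theorem key_add (e f : Exponent n) : key (e + f) = key e + key f := by
  apply ofLex.injective
  refine Prod.ext ?_ rfl
  apply ofLex.injective
  funext s
  exact neg_add _ _

/-- Monomials are compared through `Exponent.key`. -/
instance : LinearOrder (Exponent n) := LinearOrder.lift' key key_injective

theorem le_iff_key {e f : Exponent n} : e ≤ f ↔ key e ≤ key f := Iff.rfl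

instance : IsOrderedCancelAddMonoid (Exponent n) :=
  Function.Injective.isOrderedCancelAddMonoid key key_add Iff.rfl

/-- The exponent of the monomial `x ^ γ ∂ ^ γ`. -/
def diag (γ : Fin n → ℕ) : Exponent n := (fun s => (γ s : ℤ), fun s => (γ s : ℤ))

@[simp] theorem x_diag (γ : Fin n → ℕ) (s : Fin n) : (diag γ).x s = γ s := rfl
@[simp] theorem d_diag (γ : Fin n → ℕ) (s : Fin n) : (diag γ).d s = γ s := rfl

theorem diag_injective : Function.Injective (diag (n := n)) := by
  intro γ δ h
  funext s
  have := congrArg (fun e : Exponent n => e.x s) h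
  simpa using this

theorem diag_add (γ δ : Fin n → ℕ) : diag (γ + δ) = diag γ + diag δ := by
  refine Exponent.ext (funext fun s => ?_) (funext fun s => ?_) <;> simp

theorem neg_diag_monotone : Monotone fun γ : Fin n → ℕ => -diag γ := by
  intro γ δ h
  rcases h.eq_or_lt with rfl | h
  · exact le_rfl
  rw [le_iff_key]
  refine Prod.Lex.toLex_le_toLex.2 (Or.inl ?_)
  refine Pi.toLex_strictMono ?_
  rw [Pi.lt_def] at h ⊢
  obtain ⟨h1, s, h2⟩ := h
  refine ⟨fun t => ?_, OrderDual.toDual s, ?_⟩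
  · have := h1 (OrderDual.ofDual t)
    simpa using this
  · simpa using h2

theorem isPWO_range_neg_diag : (Set.range fun γ : Fin n → ℕ => -diag γ).IsPWO := by
  rw [← Set.image_univ]
  exact (Set.isPWO_of_wellQuasiOrderedLE _).image_of_monotone neg_diag_monotone

end Exponent

open Finset in
/-- The identity behind the associativity of the Leibniz multiplication in one variable. -/
theorem leibniz_assoc_one (b₁ b₂ a₂ a₃ : ℤ) (d : ℕ) :
    ∑ p ∈ antidiagonal d, (Ring.choose b₁ p.1 * (descPochhammer ℤ p.1).eval a₂) *
        (Ring.choose (b₁ + b₂ - p.1) p.2 * (descPochhammer ℤ p.2).eval a₃) =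
      ∑ p ∈ antidiagonal d, (Ring.choose b₂ p.2 * (descPochhammer ℤ p.2).eval a₃) *
        (Ring.choose b₁ p.1 * (descPochhammer ℤ p.1).eval (a₂ + a₃ - p.2)) := by
  have h1 : ∀ p q : ℕ, Ring.choose (b₁ + b₂ - p) q =
      ∑ r ∈ antidiagonal q, Ring.choose (b₁ - p) r.1 * Ring.choose b₂ r.2 := by
    intro p q
    rw [← Ring.add_choose_eq q (Commute.all _ _)]
    congr 1
    ring
  have h2 : ∀ p r : ℕ, Ring.choose b₁ p * Ring.choose (b₁ - p) r =
      ((p + r).choose p : ℤ) * Ring.choose b₁ (p + r) := by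
    intro p r
    have := Ring.choose_smul_choose b₁ (Nat.le_add_right p r)
    rw [Nat.add_sub_cancel_left] at this
    rw [← this, nsmul_eq_mul]
  have h3 : ∀ p q : ℕ, (descPochhammer ℤ p).eval (a₂ + a₃ - q) =
      ∑ r ∈ antidiagonal p, (p.choose r.1 : ℤ) *
        ((descPochhammer ℤ r.1).eval a₂ * (descPochhammer ℤ r.2).eval (a₃ - q)) := by
    intro p q
    have := Ring.descPochhammer_smeval_add p (Commute.all a₂ (a₃ - q))
    simp only [← Polynomial.eval_eq_smeval] at this
    rw [← this]
    congr 1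
    ring
  have h4 : ∀ q r : ℕ, (descPochhammer ℤ q).eval a₃ * (descPochhammer ℤ r).eval (a₃ - q) =
      (descPochhammer ℤ (q + r)).eval a₃ := by
    intro q r
    rw [← descPochhammer_mul]
    simp
  have e1 : ∑ p ∈ antidiagonal d, (Ring.choose b₁ p.1 * (descPochhammer ℤ p.1).eval a₂) *
        (Ring.choose (b₁ + b₂ - p.1) p.2 * (descPochhammer ℤ p.2).eval a₃) =
      ∑ p ∈ antidiagonal d, ∑ r ∈ antidiagonal p.2, ((p.1 + r.1).choose p.1 : ℤ) *
        Ring.choose b₁ (p.1 + r.1) * (descPochhammer ℤ p.1).eval a₂ *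
        (descPochhammer ℤ (r.2 + r.1)).eval a₃ * Ring.choose b₂ r.2 := by
    refine sum_congr rfl fun p _ => ?_
    rw [h1, Finset.sum_mul, Finset.mul_sum]
    refine sum_congr rfl fun r hr => ?_
    rw [← h2, add_comm r.2, HasAntidiagonal.mem_antidiagonal.1 hr]
    ring
  have e2 : ∑ p ∈ antidiagonal d, (Ring.choose b₂ p.2 * (descPochhammer ℤ p.2).eval a₃) *
        (Ring.choose b₁ p.1 * (descPochhammer ℤ p.1).eval (a₂ + a₃ - p.2)) =
      ∑ p ∈ antidiagonal d, ∑ r ∈ antidiagonal p.1, ((r.1 + r.2).choose r.1 : ℤ) *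
        Ring.choose b₁ (r.1 + r.2) * (descPochhammer ℤ r.1).eval a₂ *
        (descPochhammer ℤ (p.2 + r.2)).eval a₃ * Ring.choose b₂ p.2 := by
    refine sum_congr rfl fun p _ => ?_
    rw [h3, Finset.mul_sum, Finset.mul_sum]
    refine sum_congr rfl fun r hr => ?_
    rw [← h4, HasAntidiagonal.mem_antidiagonal.1 hr]
    ring
  rw [e1, e2, Finset.sum_sigma', Finset.sum_sigma']
  refine Finset.sum_bij' (fun x _ => ⟨(x.1.1 + x.2.1, x.2.2), (x.1.1, x.2.1)⟩)
    (fun x _ => ⟨(x.2.1, x.2.2 + x.1.2), (x.2.2, x.1.2)⟩) ?_ ?_ ?_ ?_ ?_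
  · rintro ⟨⟨p, q⟩, ⟨r, s⟩⟩ h
    simp only [mem_sigma, HasAntidiagonal.mem_antidiagonal] at h ⊢
    obtain ⟨h, rfl⟩ := h
    exact ⟨by rw [← h]; ring, trivial⟩
  · rintro ⟨⟨p, q⟩, ⟨r, s⟩⟩ h
    simp only [mem_sigma, HasAntidiagonal.mem_antidiagonal] at h ⊢
    obtain ⟨h, rfl⟩ := h
    exact ⟨by rw [← h]; ring, trivial⟩
  · rintro ⟨⟨p, q⟩, ⟨r, s⟩⟩ h
    simp only [mem_sigma, HasAntidiagonal.mem_antidiagonal] at h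
    obtain ⟨h, rfl⟩ := h
    rfl
  · rintro ⟨⟨p, q⟩, ⟨r, s⟩⟩ h
    simp only [mem_sigma, HasAntidiagonal.mem_antidiagonal] at h
    obtain ⟨h, rfl⟩ := h
    rfl
  · rintro ⟨⟨p, q⟩, ⟨r, s⟩⟩ _
    rfl

/-- The coefficient `∏ₛ (bₛ choose γₛ) · aₛ (aₛ - 1) ⋯ (aₛ - γₛ + 1)` in the Leibniz rule
`∂ ^ b · x ^ a = ∑_{γ ≥ 0} (b choose γ) (d ^ γ x ^ a) ∂ ^ (b - γ)`, where `d ^ γ` is the derivation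
`(∂/∂x₁) ^ γ₁ ⋯ (∂/∂xₙ) ^ γₙ`. -/
def leibnizCoeff {n : ℕ} (b a : Fin n → ℤ) (γ : Fin n → ℕ) : ℤ :=
  ∏ s, Ring.choose (b s) (γ s) * (descPochhammer ℤ (γ s)).eval (a s)

theorem leibnizCoeff_zero {n : ℕ} (b a : Fin n → ℤ) : leibnizCoeff b a 0 = 1 := by
  simp [leibnizCoeff]

theorem leibnizCoeff_zero_left {n : ℕ} (a : Fin n → ℤ) {γ : Fin n → ℕ} (h : γ ≠ 0) :
    leibnizCoeff 0 a γ = 0 := by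
  obtain ⟨s, hs⟩ := Function.ne_iff.1 h
  refine Finset.prod_eq_zero (Finset.mem_univ s) ?_
  have : Ring.choose (0 : ℤ) (γ s) = 0 := Ring.choose_zero_pos ℤ (Nat.pos_of_ne_zero hs)
  simp [this]

theorem leibnizCoeff_zero_right {n : ℕ} (b : Fin n → ℤ) {γ : Fin n → ℕ} (h : γ ≠ 0) :
    leibnizCoeff b 0 γ = 0 := by
  obtain ⟨s, hs⟩ := Function.ne_iff.1 h
  refine Finset.prod_eq_zero (Finset.mem_univ s) ?_
  have hs' : γ s ≠ 0 := hs
  have : (descPochhammer ℤ (γ s)).eval 0 = 0 := by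
    exact descPochhammer_ne_zero_eval_zero ℤ hs'
  simp [this]

/-- The pairs of multi-indices with sum `δ`, as functions to pairs. -/
def splittings {n : ℕ} (δ : Fin n → ℕ) : Finset (Fin n → ℕ × ℕ) :=
  Fintype.piFinset fun s => Finset.HasAntidiagonal.antidiagonal (δ s)

theorem leibniz_assoc {n : ℕ} (b₁ b₂ a₂ a₃ : Fin n → ℤ) (δ : Fin n → ℕ) :
    ∑ p ∈ splittings δ, leibnizCoeff b₁ a₂ (fun s => (p s).1) *
        leibnizCoeff (fun s => b₁ s + b₂ s - (p s).1) a₃ (fun s => (p s).2) =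
      ∑ p ∈ splittings δ, leibnizCoeff b₂ a₃ (fun s => (p s).2) *
        leibnizCoeff b₁ (fun s => a₂ s + a₃ s - (p s).2) (fun s => (p s).1) := by
  simp only [leibnizCoeff, ← Finset.prod_mul_distrib, splittings]
  rw [← Finset.prod_univ_sum
      (fun s => Finset.HasAntidiagonal.antidiagonal (δ s)) (fun s (p : ℕ × ℕ) =>
      (Ring.choose (b₁ s) p.1 * (descPochhammer ℤ p.1).eval (a₂ s)) *
        (Ring.choose (b₁ s + b₂ s - p.1) p.2 * (descPochhammer ℤ p.2).eval (a₃ s))),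
    ← Finset.prod_univ_sum
      (fun s => Finset.HasAntidiagonal.antidiagonal (δ s)) (fun s (p : ℕ × ℕ) =>
      (Ring.choose (b₂ s) p.2 * (descPochhammer ℤ p.2).eval (a₃ s)) *
        (Ring.choose (b₁ s) p.1 * (descPochhammer ℤ p.1).eval (a₂ s + a₃ s - p.2)))]
  exact Finset.prod_congr rfl fun s _ => leibniz_assoc_one _ _ _ _ _

/-- The ring `P = k((x₁))⋯((xₙ))((∂₁⁻¹))⋯((∂ₙ⁻¹))` of formal pseudo-differential operators in `n`
variables. An element is a formal sum `∑ a_{ij} x ^ i ∂ ^ j`, given by its coefficients. The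
admissible supports in an iterated Laurent series ring are the sets on which the exponent of the
last variable is bounded below and each slice, where this exponent is fixed, is admissible for the
remaining variables; these are exactly the sets which are well-ordered lexicographically, with the
last variable `∂ₙ⁻¹` as the most significant one. So, as a vector space, `P` is the space of Hahn
series for the order of `Exponent n`; compare `HahnSeries.iterateEquiv`. -/
def PsiDO (n : ℕ) (k : Type*) [Field k] : Type _ := HahnSeries (Exponent n) k

namespace PsiDO

variable {n : ℕ} {k : Type*} [Field k]

instance : AddCommGroup (PsiDO n k) := inferInstanceAs (AddCommGroup (HahnSeries (Exponent n) k))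

instance : Module k (PsiDO n k) := inferInstanceAs (Module k (HahnSeries (Exponent n) k))

/-- The coefficient of an operator at the monomial with exponent `e`. -/
def coeff (L : PsiDO n k) (e : Exponent n) : k := HahnSeries.coeff L e

/-- The set of exponents of the monomials which occur in an operator. -/
def support (L : PsiDO n k) : Set (Exponent n) := {e | L.coeff e ≠ 0}

theorem isPWO_support (L : PsiDO n k) : L.support.IsPWO := HahnSeries.isPWO_support' L

/-- An operator from its coefficients. -/
def mk (f : Exponent n → k) (hf : {e | f e ≠ 0}.IsPWO) : PsiDO n k :=
  (⟨f, hf⟩ : HahnSeries (Exponent n) k)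

@[simp] theorem coeff_mk (f : Exponent n → k) (hf : {e | f e ≠ 0}.IsPWO) (e : Exponent n) :
    (mk f hf).coeff e = f e := rfl

@[ext] theorem ext {L M : PsiDO n k} (h : ∀ e, L.coeff e = M.coeff e) : L = M :=
  HahnSeries.ext (funext h)

@[simp] theorem coeff_zero (e : Exponent n) : (0 : PsiDO n k).coeff e = 0 := rfl
@[simp] theorem coeff_add (L M : PsiDO n k) (e : Exponent n) :
    (L + M).coeff e = L.coeff e + M.coeff e := rfl
@[simp] theorem coeff_neg (L : PsiDO n k) (e : Exponent n) : (-L).coeff e = -L.coeff e := rfl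
@[simp] theorem coeff_sub (L M : PsiDO n k) (e : Exponent n) :
    (L - M).coeff e = L.coeff e - M.coeff e := rfl
@[simp] theorem coeff_smul (c : k) (L : PsiDO n k) (e : Exponent n) :
    (c • L).coeff e = c * L.coeff e := rfl

/-- The triples `(e, f, γ)` which contribute to the coefficient at `g` of a product of two
operators with supports in `S` and `T`. -/
def contributions (S T : Set (Exponent n)) (g : Exponent n) :
    Set (Exponent n × Exponent n × (Fin n → ℕ)) :=
  {t | t.1 ∈ S ∧ t.2.1 ∈ T ∧ t.1 + t.2.1 - Exponent.diag t.2.2 = g}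

open scoped Pointwise in
theorem finite_contributions {S T : Set (Exponent n)} (hS : S.IsPWO) (hT : T.IsPWO)
    (g : Exponent n) : (contributions S T g).Finite := by
  have h1 := Set.AddAntidiagonal.finite_of_isPWO hS (hT.add Exponent.isPWO_range_neg_diag) g
  have h2 : ∀ u, (Set.antidiagonal T (Set.range fun γ : Fin n → ℕ => -Exponent.diag γ) u).Finite :=
    fun u => Set.AddAntidiagonal.finite_of_isPWO hT Exponent.isPWO_range_neg_diag u
  have h3 : (⋃ p ∈ Set.antidiagonal S (T + Set.range fun γ : Fin n → ℕ => -Exponent.diag γ) g,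
      (fun q : Exponent n × Exponent n => (p.1, q)) ''
        Set.antidiagonal T (Set.range fun γ : Fin n → ℕ => -Exponent.diag γ) p.2).Finite :=
    h1.biUnion fun p _ => (h2 p.2).image _
  refine Set.Finite.of_finite_image (f := fun t : Exponent n × Exponent n × (Fin n → ℕ) =>
    (t.1, t.2.1, -Exponent.diag t.2.2)) (h3.subset ?_) ?_
  · rintro _ ⟨⟨e, f, γ⟩, ⟨he, hf, h⟩, rfl⟩
    simp only [Set.mem_iUnion]
    refine ⟨(e, f + -Exponent.diag γ), ⟨he, Set.add_mem_add hf ⟨γ, rfl⟩, ?_⟩,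
      (f, -Exponent.diag γ), ⟨hf, ⟨γ, rfl⟩, rfl⟩, rfl⟩
    simp only at h ⊢
    rw [← h]
    abel
  · rintro ⟨e, f, γ⟩ _ ⟨e', f', γ'⟩ _ h
    simp only [Prod.mk.injEq, neg_inj] at h
    obtain ⟨rfl, rfl, h⟩ := h
    rw [Exponent.diag_injective h]

open Classical in
/-- The summand of the coefficient at `g` of `L * M` that belongs to `t = (e, f, γ)`: it is the
coefficient at `g` of the `γ`-th term of the Leibniz rule for the product of the monomials of `L`
and `M` with exponents `e` and `f`,
`x ^ a ∂ ^ b · x ^ a' ∂ ^ b' = ∑_{γ ≥ 0} (b choose γ) x ^ a (d ^ γ x ^ a') ∂ ^ (b + b' - γ)`. -/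
def mulTerm (L M : PsiDO n k) (g : Exponent n) (t : Exponent n × Exponent n × (Fin n → ℕ)) : k :=
  if t.1 + t.2.1 - Exponent.diag t.2.2 = g then
    (leibnizCoeff t.1.d t.2.1.x t.2.2 : k) * (L.coeff t.1 * M.coeff t.2.1)
  else 0

theorem support_mulTerm (L M : PsiDO n k) (g : Exponent n) :
    Function.support (mulTerm L M g) ⊆ contributions L.support M.support g := by
  intro t ht
  rw [Function.mem_support, mulTerm] at ht
  split_ifs at ht with h
  · exact ⟨left_ne_zero_of_mul (right_ne_zero_of_mul ht),
      right_ne_zero_of_mul (right_ne_zero_of_mul ht), h⟩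
  · exact absurd rfl ht

theorem exists_mulTerm_ne_zero {L M : PsiDO n k} {g : Exponent n}
    (h : (∑ᶠ t, mulTerm L M g t) ≠ 0) : ∃ t, mulTerm L M g t ≠ 0 := by
  by_contra! h'
  exact h (finsum_eq_zero_of_forall_eq_zero h')

open scoped Pointwise in
/-- Multiplication of operators by the Leibniz rule. -/
instance : Mul (PsiDO n k) where
  mul L M := mk (fun g => ∑ᶠ t, mulTerm L M g t) (by
    refine ((L.isPWO_support.add M.isPWO_support).add Exponent.isPWO_range_neg_diag).mono ?_
    intro g hg
    obtain ⟨t, ht⟩ := exists_mulTerm_ne_zero hg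
    obtain ⟨h1, h2, h3⟩ := support_mulTerm L M g ht
    exact ⟨t.1 + t.2.1, Set.add_mem_add h1 h2, -Exponent.diag t.2.2, ⟨_, rfl⟩, by
      rw [← h3]; exact (sub_eq_add_neg _ _).symm⟩)

theorem coeff_mul (L M : PsiDO n k) (g : Exponent n) :
    (L * M).coeff g = ∑ᶠ t, mulTerm L M g t := rfl

theorem coeff_mul_eq_sum (L M : PsiDO n k) (g : Exponent n)
    {s : Finset (Exponent n × Exponent n × (Fin n → ℕ))}
    (hs : contributions L.support M.support g ⊆ s) :
    (L * M).coeff g = ∑ t ∈ s, mulTerm L M g t :=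
  finsum_eq_sum_of_support_subset _ ((support_mulTerm L M g).trans hs)

open Classical in
instance : One (PsiDO n k) where
  one := mk (fun e => if e = 0 then 1 else 0)
    ((Set.finite_singleton (0 : Exponent n)).isPWO.mono fun e he => by
      by_contra h
      exact he (if_neg h))

open Classical in
theorem coeff_one (e : Exponent n) : (1 : PsiDO n k).coeff e = if e = 0 then 1 else 0 := rfl

protected theorem left_distrib (L M N : PsiDO n k) : L * (M + N) = L * M + L * N := by
  ext g
  have hT := (M.isPWO_support.union N.isPWO_support)
  have hf := finite_contributions L.isPWO_support hT g
  rw [coeff_add, coeff_mul_eq_sum L (M + N) g (s := hf.toFinset),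
    coeff_mul_eq_sum L M g (s := hf.toFinset), coeff_mul_eq_sum L N g (s := hf.toFinset),
    ← Finset.sum_add_distrib]
  · refine Finset.sum_congr rfl fun t _ => ?_
    simp only [mulTerm, coeff_add]
    split_ifs <;> ring
  · rintro t ⟨h1, h2, h3⟩
    exact hf.mem_toFinset.2 ⟨h1, Or.inr h2, h3⟩
  · rintro t ⟨h1, h2, h3⟩
    exact hf.mem_toFinset.2 ⟨h1, Or.inl h2, h3⟩
  · rintro t ⟨h1, h2, h3⟩
    refine hf.mem_toFinset.2 ⟨h1, ?_, h3⟩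
    by_contra h
    simp only [support, Set.mem_union, Set.mem_ofPred_eq, not_or, not_not] at h
    exact h2 (by rw [coeff_add, h.1, h.2, add_zero])

protected theorem right_distrib (L M N : PsiDO n k) : (L + M) * N = L * N + M * N := by
  ext g
  have hT := (L.isPWO_support.union M.isPWO_support)
  have hf := finite_contributions hT N.isPWO_support g
  rw [coeff_add, coeff_mul_eq_sum (L + M) N g (s := hf.toFinset),
    coeff_mul_eq_sum L N g (s := hf.toFinset), coeff_mul_eq_sum M N g (s := hf.toFinset),
    ← Finset.sum_add_distrib]
  · refine Finset.sum_congr rfl fun t _ => ?_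
    simp only [mulTerm, coeff_add]
    split_ifs <;> ring
  · rintro t ⟨h1, h2, h3⟩
    exact hf.mem_toFinset.2 ⟨Or.inr h1, h2, h3⟩
  · rintro t ⟨h1, h2, h3⟩
    exact hf.mem_toFinset.2 ⟨Or.inl h1, h2, h3⟩
  · rintro t ⟨h1, h2, h3⟩
    refine hf.mem_toFinset.2 ⟨?_, h2, h3⟩
    by_contra h
    simp only [support, Set.mem_union, Set.mem_ofPred_eq, not_or, not_not] at h
    exact h1 (by rw [coeff_add, h.1, h.2, add_zero])

protected theorem one_mul (L : PsiDO n k) : 1 * L = L := by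
  ext g
  rw [coeff_mul, finsum_eq_single _ ((0 : Exponent n), g, (0 : Fin n → ℕ))]
  · have h0 : Exponent.diag (0 : Fin n → ℕ) = 0 := rfl
    simp [mulTerm, coeff_one, h0, leibnizCoeff_zero]
  · rintro ⟨e, f, γ⟩ h
    simp only [mulTerm, coeff_one]
    split_ifs with h1 h2
    · subst h2
      by_cases hγ : γ = 0
      · subst hγ
        refine absurd ?_ h
        have h0 : Exponent.diag (0 : Fin n → ℕ) = 0 := rfl
        rw [h0, zero_add, sub_zero] at h1
        rw [h1]
      · rw [Exponent.d_zero, leibnizCoeff_zero_left _ hγ]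
        simp
    · simp
    · rfl

protected theorem mul_one (L : PsiDO n k) : L * 1 = L := by
  ext g
  rw [coeff_mul, finsum_eq_single _ (g, (0 : Exponent n), (0 : Fin n → ℕ))]
  · have h0 : Exponent.diag (0 : Fin n → ℕ) = 0 := rfl
    simp [mulTerm, coeff_one, h0, leibnizCoeff_zero]
  · rintro ⟨e, f, γ⟩ h
    simp only [mulTerm, coeff_one]
    split_ifs with h1 h2
    · subst h2
      by_cases hγ : γ = 0
      · subst hγ
        refine absurd ?_ h
        have h0 : Exponent.diag (0 : Fin n → ℕ) = 0 := rfl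
        rw [h0, add_zero, sub_zero] at h1
        rw [h1]
      · rw [Exponent.x_zero, leibnizCoeff_zero_right _ hγ]
        simp
    · simp
    · rfl

/-- The data `(e₁, e₂, e₃, p)` which contribute to the coefficient at `g` of a triple product. -/
def contributions₃ (L M N : PsiDO n k) (g : Exponent n) :
    Set (Exponent n × Exponent n × Exponent n × (Fin n → ℕ × ℕ)) :=
  {q | q.1 ∈ L.support ∧ q.2.1 ∈ M.support ∧ q.2.2.1 ∈ N.support ∧
    q.1 + q.2.1 + q.2.2.1 - Exponent.diag (fun s => (q.2.2.2 s).1 + (q.2.2.2 s).2) = g}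

theorem diag_fst_add_snd (p : Fin n → ℕ × ℕ) :
    Exponent.diag (fun s => (p s).1 + (p s).2) =
      Exponent.diag (fun s => (p s).1) + Exponent.diag (fun s => (p s).2) :=
  Exponent.diag_add (fun s => (p s).1) (fun s => (p s).2)

open scoped Pointwise in
theorem finite_contributions₃ (L M N : PsiDO n k) (g : Exponent n) :
    (contributions₃ L M N g).Finite := by
  have h1 := finite_contributions ((L.isPWO_support.add M.isPWO_support).add
    Exponent.isPWO_range_neg_diag) N.isPWO_support g
  have h2 : ∀ u, (contributions L.support M.support u).Finite :=
    fun u => finite_contributions L.isPWO_support M.isPWO_support u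
  refine (h1.biUnion fun t _ => (h2 t.1).image
    fun r => (r.1, r.2.1, t.2.1, fun s => (r.2.2 s, t.2.2 s))).subset ?_
  rintro ⟨e₁, e₂, e₃, p⟩ ⟨he₁, he₂, he₃, h⟩
  simp only [Set.mem_iUnion]
  refine ⟨(e₁ + e₂ - Exponent.diag fun s => (p s).1, e₃, fun s => (p s).2),
    ⟨?_, he₃, ?_⟩, (e₁, e₂, fun s => (p s).1), ⟨he₁, he₂, rfl⟩, rfl⟩
  · exact ⟨e₁ + e₂, Set.add_mem_add he₁ he₂, _, ⟨_, rfl⟩, (sub_eq_add_neg _ _).symm⟩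
  · simp only [diag_fst_add_snd] at h ⊢
    rw [← h]
    abel

theorem coeff_mul_mul_left (L M N : PsiDO n k) (g : Exponent n) :
    (L * M * N).coeff g = ∑ q ∈ (finite_contributions₃ L M N g).toFinset,
      ((leibnizCoeff q.1.d q.2.1.x (fun s => (q.2.2.2 s).1) *
        leibnizCoeff (fun s => q.1.d s + q.2.1.d s - (q.2.2.2 s).1) q.2.2.1.x
          (fun s => (q.2.2.2 s).2) : ℤ) : k) *
        (L.coeff q.1 * M.coeff q.2.1 * N.coeff q.2.2.1) := by
  classical
  have hfin : ∀ u, (contributions L.support M.support u).Finite :=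
    fun u => finite_contributions L.isPWO_support M.isPWO_support u
  set S : Finset (Exponent n × Exponent n × (Fin n → ℕ)) :=
    (finite_contributions₃ L M N g).toFinset.image fun q =>
      (q.1 + q.2.1 - Exponent.diag (fun s => (q.2.2.2 s).1), q.2.2.1, fun s => (q.2.2.2 s).2)
    with hSdef
  have hS : ∀ t ∈ S, t.2.1 ∈ N.support ∧ t.1 + t.2.1 - Exponent.diag t.2.2 = g := by
    intro t ht
    obtain ⟨⟨e₁, e₂, e₃, p⟩, hq, rfl⟩ := Finset.mem_image.1 ht
    obtain ⟨-, -, h3, h⟩ := (Set.Finite.mem_toFinset _).1 hq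
    refine ⟨h3, ?_⟩
    simp only [diag_fst_add_snd] at h ⊢
    rw [← h]
    abel
  have hS' : ∀ (t : Exponent n × Exponent n × (Fin n → ℕ)), ∀ r ∈ (hfin t.1).toFinset,
      t.2.1 ∈ N.support → t.1 + t.2.1 - Exponent.diag t.2.2 = g →
      (r.1, r.2.1, t.2.1, fun s => (r.2.2 s, t.2.2 s)) ∈ contributions₃ L M N g := by
    rintro ⟨u, e₃, γ₂⟩ ⟨e₁, e₂, γ₁⟩ hr hN hg
    obtain ⟨h1, h2, h3⟩ := (Set.Finite.mem_toFinset _).1 hr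
    refine ⟨h1, h2, hN, ?_⟩
    simp only at h3 hg ⊢
    rw [← hg, ← h3, diag_fst_add_snd (fun s => (γ₁ s, γ₂ s))]
    abel
  rw [coeff_mul_eq_sum (L * M) N g (s := S)]
  · have e1 : ∀ t ∈ S, mulTerm (L * M) N g t = ∑ r ∈ (hfin t.1).toFinset,
        (leibnizCoeff t.1.d t.2.1.x t.2.2 : k) *
        ((leibnizCoeff r.1.d r.2.1.x r.2.2 : k) * (L.coeff r.1 * M.coeff r.2.1) *
          N.coeff t.2.1) := by
      intro t ht
      rw [mulTerm, if_pos (hS t ht).2,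
        coeff_mul_eq_sum L M t.1 (s := (hfin t.1).toFinset) (by simp), Finset.sum_mul,
        Finset.mul_sum]
      refine Finset.sum_congr rfl fun r hr => ?_
      rw [mulTerm, if_pos ((Set.Finite.mem_toFinset _).1 hr).2.2]
    rw [Finset.sum_congr rfl e1, Finset.sum_sigma']
    refine Finset.sum_bij' (fun a _ => (a.2.1, a.2.2.1, a.1.2.1, fun s => (a.2.2.2 s, a.1.2.2 s)))
      (fun q _ => ⟨(q.1 + q.2.1 - Exponent.diag (fun s => (q.2.2.2 s).1), q.2.2.1,
        fun s => (q.2.2.2 s).2), (q.1, q.2.1, fun s => (q.2.2.2 s).1)⟩) ?_ ?_ ?_ ?_ ?_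
    · rintro ⟨t, r⟩ h
      obtain ⟨ht, hr⟩ := Finset.mem_sigma.1 h
      exact (Set.Finite.mem_toFinset _).2 (hS' t r hr (hS t ht).1 (hS t ht).2)
    · intro q hq
      refine Finset.mem_sigma.2 ⟨Finset.mem_image.2 ⟨q, hq, rfl⟩, ?_⟩
      obtain ⟨h1, h2, -, -⟩ := (Set.Finite.mem_toFinset _).1 hq
      exact (Set.Finite.mem_toFinset _).2 ⟨h1, h2, rfl⟩
    · rintro ⟨⟨u, e₃, γ₂⟩, ⟨e₁, e₂, γ₁⟩⟩ h
      obtain ⟨ht, hr⟩ := Finset.mem_sigma.1 h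
      obtain ⟨-, -, h3⟩ := (Set.Finite.mem_toFinset _).1 hr
      simp only at h3
      subst h3
      rfl
    · rintro ⟨e₁, e₂, e₃, p⟩ _
      rfl
    · rintro ⟨⟨u, e₃, γ₂⟩, ⟨e₁, e₂, γ₁⟩⟩ h
      obtain ⟨ht, hr⟩ := Finset.mem_sigma.1 h
      obtain ⟨-, -, h3⟩ := (Set.Finite.mem_toFinset _).1 hr
      simp only at h3
      have hd : u.d = fun s => e₁.d s + e₂.d s - (γ₁ s : ℤ) := by
        rw [← h3]
        rfl
      simp only [hd]
      push_cast
      ring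
  · rintro ⟨u, e₃, γ₂⟩ ⟨h1, h2, h3⟩
    obtain ⟨r, hr⟩ := exists_mulTerm_ne_zero h1
    have hr' := support_mulTerm L M u hr
    refine Finset.mem_coe.2 (Finset.mem_image.2 ⟨_, (Set.Finite.mem_toFinset _).2
      (hS' (u, e₃, γ₂) r ((Set.Finite.mem_toFinset _).2 hr') h2 h3), ?_⟩)
    have := hr'.2.2
    simp only at this ⊢
    rw [this]

theorem coeff_mul_mul_right (L M N : PsiDO n k) (g : Exponent n) :
    (L * (M * N)).coeff g = ∑ q ∈ (finite_contributions₃ L M N g).toFinset,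
      ((leibnizCoeff q.2.1.d q.2.2.1.x (fun s => (q.2.2.2 s).2) *
        leibnizCoeff q.1.d (fun s => q.2.1.x s + q.2.2.1.x s - (q.2.2.2 s).2)
          (fun s => (q.2.2.2 s).1) : ℤ) : k) *
        (L.coeff q.1 * M.coeff q.2.1 * N.coeff q.2.2.1) := by
  classical
  have hfin : ∀ u, (contributions M.support N.support u).Finite :=
    fun u => finite_contributions M.isPWO_support N.isPWO_support u
  set S : Finset (Exponent n × Exponent n × (Fin n → ℕ)) :=
    (finite_contributions₃ L M N g).toFinset.image fun q =>
      (q.1, q.2.1 + q.2.2.1 - Exponent.diag (fun s => (q.2.2.2 s).2), fun s => (q.2.2.2 s).1)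
    with hSdef
  have hS : ∀ t ∈ S, t.1 ∈ L.support ∧ t.1 + t.2.1 - Exponent.diag t.2.2 = g := by
    intro t ht
    obtain ⟨⟨e₁, e₂, e₃, p⟩, hq, rfl⟩ := Finset.mem_image.1 ht
    obtain ⟨h1, -, -, h⟩ := (Set.Finite.mem_toFinset _).1 hq
    refine ⟨h1, ?_⟩
    simp only [diag_fst_add_snd] at h ⊢
    rw [← h]
    abel
  have hS' : ∀ (t : Exponent n × Exponent n × (Fin n → ℕ)), ∀ r ∈ (hfin t.2.1).toFinset,
      t.1 ∈ L.support → t.1 + t.2.1 - Exponent.diag t.2.2 = g →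
      (t.1, r.1, r.2.1, fun s => (t.2.2 s, r.2.2 s)) ∈ contributions₃ L M N g := by
    rintro ⟨e₁, u, γ₁⟩ ⟨e₂, e₃, γ₂⟩ hr hL hg
    obtain ⟨h1, h2, h3⟩ := (Set.Finite.mem_toFinset _).1 hr
    refine ⟨hL, h1, h2, ?_⟩
    simp only at h3 hg ⊢
    rw [← hg, ← h3, diag_fst_add_snd (fun s => (γ₁ s, γ₂ s))]
    abel
  rw [coeff_mul_eq_sum L (M * N) g (s := S)]
  · have e1 : ∀ t ∈ S, mulTerm L (M * N) g t = ∑ r ∈ (hfin t.2.1).toFinset,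
        (leibnizCoeff t.1.d t.2.1.x t.2.2 : k) * (L.coeff t.1 *
        ((leibnizCoeff r.1.d r.2.1.x r.2.2 : k) * (M.coeff r.1 * N.coeff r.2.1))) := by
      intro t ht
      rw [mulTerm, if_pos (hS t ht).2,
        coeff_mul_eq_sum M N t.2.1 (s := (hfin t.2.1).toFinset) (by simp), Finset.mul_sum,
        Finset.mul_sum]
      refine Finset.sum_congr rfl fun r hr => ?_
      rw [mulTerm, if_pos ((Set.Finite.mem_toFinset _).1 hr).2.2]
    rw [Finset.sum_congr rfl e1, Finset.sum_sigma']
    refine Finset.sum_bij' (fun a _ => (a.1.1, a.2.1, a.2.2.1, fun s => (a.1.2.2 s, a.2.2.2 s)))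
      (fun q _ => ⟨(q.1, q.2.1 + q.2.2.1 - Exponent.diag (fun s => (q.2.2.2 s).2),
        fun s => (q.2.2.2 s).1), (q.2.1, q.2.2.1, fun s => (q.2.2.2 s).2)⟩) ?_ ?_ ?_ ?_ ?_
    · rintro ⟨t, r⟩ h
      obtain ⟨ht, hr⟩ := Finset.mem_sigma.1 h
      exact (Set.Finite.mem_toFinset _).2 (hS' t r hr (hS t ht).1 (hS t ht).2)
    · intro q hq
      refine Finset.mem_sigma.2 ⟨Finset.mem_image.2 ⟨q, hq, rfl⟩, ?_⟩
      obtain ⟨-, h1, h2, -⟩ := (Set.Finite.mem_toFinset _).1 hq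
      exact (Set.Finite.mem_toFinset _).2 ⟨h1, h2, rfl⟩
    · rintro ⟨⟨e₁, u, γ₁⟩, ⟨e₂, e₃, γ₂⟩⟩ h
      obtain ⟨ht, hr⟩ := Finset.mem_sigma.1 h
      obtain ⟨-, -, h3⟩ := (Set.Finite.mem_toFinset _).1 hr
      simp only at h3
      subst h3
      rfl
    · rintro ⟨e₁, e₂, e₃, p⟩ _
      rfl
    · rintro ⟨⟨e₁, u, γ₁⟩, ⟨e₂, e₃, γ₂⟩⟩ h
      obtain ⟨ht, hr⟩ := Finset.mem_sigma.1 h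
      obtain ⟨-, -, h3⟩ := (Set.Finite.mem_toFinset _).1 hr
      simp only at h3
      have hx : u.x = fun s => e₂.x s + e₃.x s - (γ₂ s : ℤ) := by
        rw [← h3]
        rfl
      simp only [hx]
      push_cast
      ring
  · rintro ⟨e₁, u, γ₁⟩ ⟨h1, h2, h3⟩
    obtain ⟨r, hr⟩ := exists_mulTerm_ne_zero h2
    have hr' := support_mulTerm M N u hr
    refine Finset.mem_coe.2 (Finset.mem_image.2 ⟨_, (Set.Finite.mem_toFinset _).2
      (hS' (e₁, u, γ₁) r ((Set.Finite.mem_toFinset _).2 hr') h1 h3), ?_⟩)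
    have := hr'.2.2
    simp only at this ⊢
    rw [this]

theorem sum_contributions₃ (L M N : PsiDO n k) (g : Exponent n) :
    ∃ T : Finset (Exponent n × Exponent n × Exponent n × (Fin n → ℕ)),
      ∀ F : Exponent n → Exponent n → Exponent n → (Fin n → ℕ × ℕ) → k,
      ∑ q ∈ (finite_contributions₃ L M N g).toFinset, F q.1 q.2.1 q.2.2.1 q.2.2.2 =
        ∑ t ∈ T, ∑ p ∈ splittings t.2.2.2, F t.1 t.2.1 t.2.2.1 p := by
  classical
  refine ⟨(finite_contributions₃ L M N g).toFinset.image fun q =>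
    (q.1, q.2.1, q.2.2.1, fun s => (q.2.2.2 s).1 + (q.2.2.2 s).2), fun F => ?_⟩
  rw [Finset.sum_sigma']
  symm
  refine Finset.sum_bij' (fun a _ => (a.1.1, a.1.2.1, a.1.2.2.1, a.2))
    (fun q _ => ⟨(q.1, q.2.1, q.2.2.1, fun s => (q.2.2.2 s).1 + (q.2.2.2 s).2), q.2.2.2⟩)
    ?_ ?_ ?_ ?_ ?_
  · rintro ⟨⟨e₁, e₂, e₃, δ⟩, p⟩ h
    obtain ⟨h1, h2⟩ := Finset.mem_sigma.1 h
    obtain ⟨⟨e₁', e₂', e₃', p'⟩, hq, h3⟩ := Finset.mem_image.1 h1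
    simp only [Prod.mk.injEq] at h3
    obtain ⟨rfl, rfl, rfl, h3⟩ := h3
    obtain ⟨k1, k2, k3, k4⟩ := (Set.Finite.mem_toFinset _).1 hq
    refine (Set.Finite.mem_toFinset _).2 ⟨k1, k2, k3, ?_⟩
    have : (fun s => (p s).1 + (p s).2) = δ := funext fun s =>
      Finset.HasAntidiagonal.mem_antidiagonal.1 (Fintype.mem_piFinset.1 h2 s)
    simp only [this]
    simp only [h3] at k4
    exact k4
  · intro q hq
    refine Finset.mem_sigma.2 ⟨Finset.mem_image.2 ⟨q, hq, rfl⟩, Fintype.mem_piFinset.2 fun s =>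
      Finset.HasAntidiagonal.mem_antidiagonal.2 rfl⟩
  · rintro ⟨⟨e₁, e₂, e₃, δ⟩, p⟩ h
    obtain ⟨h1, h2⟩ := Finset.mem_sigma.1 h
    have : (fun s => (p s).1 + (p s).2) = δ := funext fun s =>
      Finset.HasAntidiagonal.mem_antidiagonal.1 (Fintype.mem_piFinset.1 h2 s)
    subst this
    rfl
  · rintro ⟨e₁, e₂, e₃, p⟩ _
    rfl
  · rintro ⟨⟨e₁, e₂, e₃, δ⟩, p⟩ _
    rfl

protected theorem mul_assoc (L M N : PsiDO n k) : L * M * N = L * (M * N) := by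
  ext g
  obtain ⟨T, hT⟩ := sum_contributions₃ L M N g
  rw [coeff_mul_mul_left, coeff_mul_mul_right,
    hT fun e₁ e₂ e₃ p => ((leibnizCoeff e₁.d e₂.x (fun s => (p s).1) *
        leibnizCoeff (fun s => e₁.d s + e₂.d s - (p s).1) e₃.x (fun s => (p s).2) : ℤ) : k) *
        (L.coeff e₁ * M.coeff e₂ * N.coeff e₃),
    hT fun e₁ e₂ e₃ p => ((leibnizCoeff e₂.d e₃.x (fun s => (p s).2) *
        leibnizCoeff e₁.d (fun s => e₂.x s + e₃.x s - (p s).2) (fun s => (p s).1) : ℤ) : k) *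
        (L.coeff e₁ * M.coeff e₂ * N.coeff e₃)]
  refine Finset.sum_congr rfl fun t _ => ?_
  rw [← Finset.sum_mul, ← Finset.sum_mul, ← Int.cast_sum, ← Int.cast_sum, leibniz_assoc]

/-- The associative ring of formal pseudo-differential operators. -/
instance : Ring (PsiDO n k) where
  __ := (inferInstance : AddCommGroup (PsiDO n k))
  left_distrib := PsiDO.left_distrib
  right_distrib := PsiDO.right_distrib
  zero_mul L := by
    have h := PsiDO.right_distrib 0 0 L
    rwa [add_zero, left_eq_add] at h
  mul_zero L := by
    have h := PsiDO.left_distrib L 0 0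
    rwa [add_zero, left_eq_add] at h
  mul_assoc := PsiDO.mul_assoc
  one_mul := PsiDO.one_mul
  mul_one := PsiDO.mul_one

/-- The residue of an operator: its coefficient at `x₁⁻¹ ⋯ xₙ⁻¹ ∂₁⁻¹ ⋯ ∂ₙ⁻¹`. -/
def res (L : PsiDO n k) : k := L.coeff (-Exponent.diag 1)

open Classical in
/-- The projection of `P = P₊ ⊕ P₋` to `P₊`, the operators which contain only nonnegative powers of
the last variable `∂ₙ`. -/
def plus (L : PsiDO n k) : PsiDO n k :=
  mk (fun e => if ∀ s : Fin n, (s : ℕ) + 1 = n → 0 ≤ e.d s then L.coeff e else 0)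
    (L.isPWO_support.mono fun e he => by
      by_contra h
      refine he ?_
      split_ifs
      · exact not_not.1 h
      · rfl)

/-- The projection of `P = P₊ ⊕ P₋` to `P₋`, the operators which contain only negative powers of
the last variable `∂ₙ`. -/
def minus (L : PsiDO n k) : PsiDO n k := L - plus L

/-- The difference of the projectors to `P₊` and to `P₋`. -/
def rMatrix (L : PsiDO n k) : PsiDO n k := plus L - minus L

/-- The `R`-bracket `½ [R X, Y] + ½ [X, R Y]` on `P`. -/
def rBracket (X Y : PsiDO n k) : PsiDO n k :=
  (1 / 2 : k) • ⁅rMatrix X, Y⁆ + (1 / 2 : k) • ⁅X, rMatrix Y⁆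

end PsiDO

/-- The space `Pⁿ` of `n`-tuples of operators; it is also the tangent space at each of its
points. -/
abbrev PhaseSpace (n : ℕ) (k : Type*) [Field k] : Type _ := Fin n → PsiDO n k

namespace PhaseSpace

variable {n : ℕ} {k : Type*} [Field k]

/-- The subvariety `P'` of `Pⁿ` of the tuples of pairwise commuting operators. -/
def commuting (n : ℕ) (k : Type*) [Field k] : Set (PhaseSpace n k) :=
  {L | ∀ i j, ⁅L i, L j⁆ = 0}

/-- The operator `L ^ m = L₁ ^ m₁ ⋯ Lₙ ^ mₙ`, multiplied in this order. -/
def monomial (L : PhaseSpace n k) (m : Fin n → ℕ) : PsiDO n k :=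
  (List.ofFn fun i => L i ^ m i).prod

/-- The function `H_m(L) = res (L ^ m)` on `Pⁿ`. -/
def hamiltonian (m : Fin n → ℕ) (L : PhaseSpace n k) : k := (L.monomial m).res

/-- The bilinear form `⟨L, M⟩ = ∑ᵢ res (Lᵢ Mᵢ)` on `Pⁿ`. -/
def pairing (L M : PhaseSpace n k) : k := ∑ i, (L i * M i).res

/-- The value at `L` of a monomial `μ` in the coefficients of the operators `L₁, …, Lₙ`; the
variable `(i, e)` stands for the coefficient of `Lᵢ` at the monomial with exponent `e`. -/
def coordMonomial (L : PhaseSpace n k) (μ : Fin n × Exponent n →₀ ℕ) : k :=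
  μ.prod fun v r => (L v.1).coeff v.2 ^ r

/-- `F` is the function on `Pⁿ` given by the formal polynomial `∑ c_μ μ` of bounded degree in the
coefficients of the operators `L₁, …, Lₙ`. Any number of coefficients may occur, but at each point
of `Pⁿ` only finitely many summands are nonzero. -/
structure IsGivenBy (F : PhaseSpace n k → k) (c : (Fin n × Exponent n →₀ ℕ) → k) : Prop where
  bounded_degree : ∃ N : ℕ, ∀ μ, c μ ≠ 0 → μ.degree ≤ N
  finite_support : ∀ L : PhaseSpace n k, {μ | c μ * L.coordMonomial μ ≠ 0}.Finite
  eq_finsum : ∀ L : PhaseSpace n k, F L = ∑ᶠ μ, c μ * L.coordMonomial μ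

/-- The vector space `𝓕(Pⁿ)` of functionals: the functions on `Pⁿ` which are polynomial in any
number of coefficients of the operators `L₁, …, Lₙ`. -/
def functionals (n : ℕ) (k : Type*) [Field k] : Submodule k (PhaseSpace n k → k) where
  carrier := {F | ∃ c, IsGivenBy F c}
  zero_mem' := ⟨0, ⟨0, fun _ h => absurd rfl h⟩, fun L => by simp, fun L => by simp⟩
  add_mem' := by
    rintro F G ⟨c, ⟨N, hN⟩, hc, hF⟩ ⟨c', ⟨N', hN'⟩, hc', hG⟩
    refine ⟨c + c', ⟨max N N', fun μ hμ => ?_⟩, fun L => ?_, fun L => ?_⟩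
    · by_cases h : c μ = 0
      · by_cases h' : c' μ = 0
        · exact absurd (show c μ + c' μ = 0 by rw [h, h', add_zero]) hμ
        · exact (hN' μ h').trans (le_max_right _ _)
      · exact (hN μ h).trans (le_max_left _ _)
    · refine ((hc L).union (hc' L)).subset fun μ hμ => ?_
      by_contra h
      simp only [Set.mem_union, Set.mem_ofPred_eq, not_or, not_not] at h
      refine hμ ?_
      change (c μ + c' μ) * _ = 0
      rw [add_mul, h.1, h.2, add_zero]
    · rw [Pi.add_apply, hF, hG, ← finsum_add_distrib (hc L) (hc' L)]
      exact finsum_congr fun μ => (add_mul _ _ _).symm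
  smul_mem' := by
    rintro a F ⟨c, ⟨N, hN⟩, hc, hF⟩
    have e : ∀ (L : PhaseSpace n k) (μ : Fin n × Exponent n →₀ ℕ),
        (a • c) μ * L.coordMonomial μ = a * (c μ * L.coordMonomial μ) :=
      fun L μ => mul_assoc _ _ _
    refine ⟨a • c, ⟨N, fun μ hμ => hN μ fun h => hμ ?_⟩, fun L => ?_, fun L => ?_⟩
    · change a * c μ = 0
      rw [h, mul_zero]
    · refine (hc L).subset fun μ hμ h => hμ ?_
      rw [e, h, mul_zero]
    · rw [Pi.smul_apply, hF, finsum_congr (e L), smul_eq_mul, mul_finsum]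

/-- `a` is the derivative `d/dε F(L + ε M)` at `ε = 0`: the function `ε ↦ F(L + ε M)` is a
polynomial with derivative `a` at `0`. -/
def HasDirDeriv (F : PhaseSpace n k → k) (L M : PhaseSpace n k) (a : k) : Prop :=
  ∃ p : Polynomial k, (∀ ε : k, F (L + ε • M) = p.eval ε) ∧ p.derivative.eval 0 = a

/-- `U` is the gradient of `F` at the point `L`. -/
def IsGradient (F : PhaseSpace n k → k) (L U : PhaseSpace n k) : Prop :=
  ∀ M : PhaseSpace n k, HasDirDeriv F L M (pairing M U)

open Classical in
/-- The gradient of `F` at the point `L` (and `0` if there is none). -/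
def gradient (F : PhaseSpace n k → k) (L : PhaseSpace n k) : PhaseSpace n k :=
  if h : ∃ U, IsGradient F L U then h.choose else 0

/-- The Poisson bracket `{F, G}_R (L) = ⟨L, [∇F(L), ∇G(L)]_R⟩`. -/
def poissonBracketR (F G : PhaseSpace n k → k) (L : PhaseSpace n k) : k :=
  pairing L fun i => (gradient F L i).rBracket (gradient G L i)

/-- The velocity `X = ∂L/∂t` of a point `L` of `Pⁿ` obeys the Hamiltonian system
`∂F/∂t = {F, H}_R`, `F ∈ 𝓕(Pⁿ)`, where `∂F/∂t` is the derivative of `F` at `L` along `X`. -/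
def IsHamiltonianVelocity (H : PhaseSpace n k → k) (L X : PhaseSpace n k) : Prop :=
  ∀ F ∈ functionals n k, HasDirDeriv F L X (poissonBracketR F H L)

end PhaseSpace

end

noncomputable section

theorem descPochhammer_eval_sub (c : ℕ) (a : ℤ) :
    (descPochhammer ℤ c).eval (c - 1 - a) = (-1) ^ c * (descPochhammer ℤ c).eval a := by
  rw [descPochhammer_eval_eq_prod_range, descPochhammer_eval_eq_prod_range,
    ← Finset.prod_range_reflect, ← Finset.card_range c, ← Finset.prod_const,
    Finset.card_range, ← Finset.prod_mul_distrib]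
  refine Finset.prod_congr rfl fun j hj => ?_
  have : ((c - 1 - j : ℕ) : ℤ) = c - 1 - j := by
    have := Finset.mem_range.1 hj
    omega
  rw [this]
  ring

theorem choose_mul_descPochhammer_symm {a a' b b' : ℤ} {c : ℕ} (ha : a + a' = c - 1)
    (hb : b + b' = c - 1) :
    Ring.choose b c * (descPochhammer ℤ c).eval a' =
      Ring.choose b' c * (descPochhammer ℤ c).eval a := by
  have hc : ∀ z : ℤ, (descPochhammer ℤ c).eval z = (c.factorial : ℤ) * Ring.choose z c := by
    intro z
    rw [Polynomial.eval_eq_smeval, Ring.descPochhammer_eq_factorial_smul_choose, nsmul_eq_mul]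
  have h0 : (c.factorial : ℤ) ≠ 0 := by exact_mod_cast c.factorial_ne_zero
  obtain rfl : a' = c - 1 - a := by linarith
  obtain rfl : b' = c - 1 - b := by linarith
  refine mul_left_cancel₀ h0 ?_
  rw [← mul_assoc, ← mul_assoc, ← hc, ← hc, descPochhammer_eval_sub, descPochhammer_eval_sub]
  ring

theorem leibnizCoeff_symm {n : ℕ} {a a' b b' : Fin n → ℤ} {γ : Fin n → ℕ}
    (ha : ∀ s, a s + a' s = γ s - 1) (hb : ∀ s, b s + b' s = γ s - 1) :
    leibnizCoeff b a' γ = leibnizCoeff b' a γ :=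
  Finset.prod_congr rfl fun s _ => choose_mul_descPochhammer_symm (ha s) (hb s)

theorem leibnizCoeff_eq_zero {n : ℕ} {b : Fin n → ℤ} (a : Fin n → ℤ) {γ : Fin n → ℕ}
    (hb : ∀ s, b s = γ s - 1) (hγ : γ ≠ 0) : leibnizCoeff b a γ = 0 := by
  obtain ⟨s, hs⟩ := Function.ne_iff.1 hγ
  have hs' : 1 ≤ γ s := Nat.one_le_iff_ne_zero.2 hs
  refine Finset.prod_eq_zero (Finset.mem_univ s) ?_
  have : b s = ((γ s - 1 : ℕ) : ℤ) := by rw [hb]; push_cast [hs']; ring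
  rw [this, Ring.choose_natCast, Nat.choose_eq_zero_of_lt (by omega)]
  simp

/-- The sum which computes the product of a normally ordered monomial with a monomial in the
opposite order. -/
theorem sum_splittings_leibnizCoeff {n : ℕ} (b b' a : Fin n → ℤ) (δ : Fin n → ℕ) :
    ∑ p ∈ splittings δ, leibnizCoeff b' a (fun s => (p s).2) *
        leibnizCoeff b (fun s => a s - (p s).2) (fun s => (p s).1) =
      leibnizCoeff (fun s => b s + b' s) a δ := by
  have h := leibniz_assoc b b' 0 a δ
  simp only [Pi.zero_apply, zero_add] at h
  rw [← h, Finset.sum_eq_single (fun s => (0, δ s))]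
  · have : leibnizCoeff b 0 (fun _ => 0) = 1 := leibnizCoeff_zero b 0
    simp [this]
  · intro p hp hp'
    have : (fun s => (p s).1) ≠ 0 := by
      intro h0
      refine hp' (funext fun s => ?_)
      have h1 := Finset.HasAntidiagonal.mem_antidiagonal.1 (Fintype.mem_piFinset.1 hp s)
      have h2 : (p s).1 = 0 := congrFun h0 s
      exact Prod.ext h2 (by simpa [h2] using h1)
    rw [leibnizCoeff_zero_right _ this, zero_mul]
  · intro h
    refine absurd (Fintype.mem_piFinset.2 fun s => ?_) h
    simp

/-- A finitely supported sum can be computed fibrewise. -/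
theorem finsum_fiberwise {α β R : Type*} [AddCommMonoid R] [DecidableEq β] (φ : α → β)
    {f : α → R} (hf : (Function.support f).Finite) :
    ∑ᶠ a, f a = ∑ᶠ b, ∑ᶠ a, if φ a = b then f a else 0 := by
  have h1 : (Function.support fun q : α × β => if φ q.1 = q.2 then f q.1 else 0).Finite := by
    refine (hf.image fun a => (a, φ a)).subset ?_
    rintro ⟨a, b⟩ h
    simp only [Function.mem_support, ne_eq, ite_eq_right_iff, not_forall] at h
    obtain ⟨rfl, h⟩ := h
    exact ⟨a, h, rfl⟩
  have h2 := finsum_curry _ h1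
  have h3 := finsum_curry (fun q : β × α => if φ q.2 = q.1 then f q.2 else 0)
    ((h1.image Prod.swap).subset (by rintro ⟨b, a⟩ h; exact ⟨(a, b), h, rfl⟩))
  rw [← finsum_comp_equiv (Equiv.prodComm α β)] at h3
  simp only [Equiv.prodComm_apply, Prod.fst_swap, Prod.snd_swap] at h3
  refine (Eq.trans (finsum_congr fun a => ?_) h2.symm).trans h3
  rw [finsum_eq_single _ (φ a) fun b hb => if_neg (Ne.symm hb), if_pos rfl]

theorem finsum_mul_finsum_prod {α β R : Type*} [NonUnitalNonAssocSemiring R]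
    {f : α → R} {g : β → R}
    (hf : (Function.support f).Finite) (hg : (Function.support g).Finite) :
    (∑ᶠ a, f a) * ∑ᶠ b, g b = ∑ᶠ q : α × β, f q.1 * g q.2 := by
  rw [finsum_curry, finsum_mul' _ _ hf]
  · exact finsum_congr fun a => mul_finsum' _ _ hg
  · refine (hf.prod hg).subset ?_
    rintro ⟨a, b⟩ h
    exact ⟨fun h0 => h (by simp [h0]), fun h0 => h (by simp [h0])⟩

namespace PsiDO

variable {n : ℕ} {k : Type*} [Field k]

instance : IsScalarTower k (PsiDO n k) (PsiDO n k) where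
  smul_assoc c L M := by
    ext g
    simp only [smul_eq_mul, coeff_smul, coeff_mul, mul_finsum]
    refine finsum_congr fun t => ?_
    simp only [mulTerm, coeff_smul]
    split_ifs <;> ring

instance : SMulCommClass k (PsiDO n k) (PsiDO n k) where
  smul_comm c L M := by
    ext g
    simp only [smul_eq_mul, coeff_smul, coeff_mul, mul_finsum]
    refine finsum_congr fun t => ?_
    simp only [mulTerm, coeff_smul]
    split_ifs <;> ring

@[simp] theorem res_zero : (0 : PsiDO n k).res = 0 := rfl
@[simp] theorem res_add (L M : PsiDO n k) : (L + M).res = L.res + M.res := rfl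
@[simp] theorem res_sub (L M : PsiDO n k) : (L - M).res = L.res - M.res := rfl
@[simp] theorem res_smul (c : k) (L : PsiDO n k) : (c • L).res = c * L.res := rfl

/-- The residue is a trace. -/
theorem res_mul_comm (L M : PsiDO n k) : (L * M).res = (M * L).res := by
  rw [res, res, coeff_mul, coeff_mul,
    ← finsum_comp_equiv ((Equiv.prodAssoc _ _ _).symm.trans
      (((Equiv.prodComm _ _).prodCongr (Equiv.refl _)).trans (Equiv.prodAssoc _ _ _)))]
  refine finsum_congr fun ⟨e, f, γ⟩ => ?_
  simp only [mulTerm, Equiv.trans_apply, Equiv.prodAssoc_symm_apply, Equiv.prodCongr_apply,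
    Prod.map_apply, Equiv.prodComm_apply, Prod.swap_prod_mk, Equiv.refl_apply,
    Equiv.prodAssoc_apply, add_comm f e]
  split_ifs with h
  · have hx : ∀ s, e.x s + f.x s = γ s - 1 := by
      intro s
      have := congrArg (fun u : Exponent n => u.x s) h
      simp at this
      linarith
    have hd : ∀ s, e.d s + f.d s = γ s - 1 := by
      intro s
      have := congrArg (fun u : Exponent n => u.d s) h
      simp at this
      linarith
    rw [leibnizCoeff_symm hx hd, mul_comm (L.coeff _)]
  · rfl

theorem res_mul_lie (A B C : PsiDO n k) : (A * ⁅B, C⁆).res = (B * ⁅C, A⁆).res := by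
  rw [Ring.lie_def, Ring.lie_def, mul_sub, mul_sub, res_sub, res_sub, ← mul_assoc B C A,
    res_mul_comm A (B * C), ← mul_assoc A C B, res_mul_comm (A * C) B]

theorem finite_setOf_add_diag_mem {S : Set (Exponent n)} (hS : S.IsPWO) (g : Exponent n) :
    {γ : Fin n → ℕ | g + Exponent.diag γ ∈ S}.Finite := by
  refine ((finite_contributions (Set.isPWO_singleton (0 : Exponent n)) hS g).image
    fun t => t.2.2).subset fun γ hγ => ?_
  refine ⟨(0, g + Exponent.diag γ, γ), ⟨rfl, hγ, ?_⟩, rfl⟩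
  simp

open scoped Pointwise in
/-- The operator `∑ v_h ∂ ^ h.d x ^ h.x`, written in normal order. -/
def ofReversed (V : PsiDO n k) : PsiDO n k :=
  mk (fun g => ∑ᶠ γ : Fin n → ℕ, (leibnizCoeff (g + Exponent.diag γ).d (g + Exponent.diag γ).x γ : k) *
      V.coeff (g + Exponent.diag γ)) <| by
    refine (V.isPWO_support.add Exponent.isPWO_range_neg_diag).mono fun g hg => ?_
    by_contra h
    refine hg (finsum_eq_zero_of_forall_eq_zero fun γ => ?_)
    by_contra h'
    refine h ⟨g + Exponent.diag γ, right_ne_zero_of_mul h', _, ⟨γ, rfl⟩, ?_⟩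
    simp

theorem coeff_ofReversed (V : PsiDO n k) (g : Exponent n) :
    (ofReversed V).coeff g = ∑ᶠ γ : Fin n → ℕ,
      (leibnizCoeff (g + Exponent.diag γ).d (g + Exponent.diag γ).x γ : k) *
        V.coeff (g + Exponent.diag γ) := rfl

theorem finsum_leibnizCoeff_ofReversed (V : PsiDO n k) (e : Exponent n) :
    ∑ᶠ γ : Fin n → ℕ, (leibnizCoeff e.d (-Exponent.diag 1 - e + Exponent.diag γ).x γ : k) *
      (ofReversed V).coeff (-Exponent.diag 1 - e + Exponent.diag γ) =
      V.coeff (-Exponent.diag 1 - e) := by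
  classical
  set u := -Exponent.diag 1 - e with hu
  have hE := finite_setOf_add_diag_mem V.isPWO_support u
  -- the summand, indexed by `p s = (γ s, δ s)`
  let G : (Fin n → ℕ × ℕ) → k := fun p =>
    (leibnizCoeff (u + Exponent.diag (fun s => (p s).1 + (p s).2)).d
        (u + Exponent.diag (fun s => (p s).1 + (p s).2)).x (fun s => (p s).2) *
      leibnizCoeff e.d (fun s => (u + Exponent.diag (fun s => (p s).1 + (p s).2)).x s - (p s).2)
        (fun s => (p s).1) : ℤ) * V.coeff (u + Exponent.diag (fun s => (p s).1 + (p s).2))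
  have hG : Function.support G ⊆ (hE.toFinset.biUnion splittings : Finset _) := by
    intro p hp
    refine Finset.mem_coe.2 (Finset.mem_biUnion.2 ⟨fun s => (p s).1 + (p s).2,
      hE.mem_toFinset.2 (right_ne_zero_of_mul hp), Fintype.mem_piFinset.2 fun s => ?_⟩)
    exact Finset.HasAntidiagonal.mem_antidiagonal.2 rfl
  have hGf : (Function.support G).Finite := (Finset.finite_toSet _).subset hG
  let σ : (Fin n → ℕ) × (Fin n → ℕ) ≃ (Fin n → ℕ × ℕ) := Equiv.arrowProdEquivProdArrow _ _ _ |>.symm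
  have h1 : ∑ᶠ γ : Fin n → ℕ, (leibnizCoeff e.d (u + Exponent.diag γ).x γ : k) *
      (ofReversed V).coeff (u + Exponent.diag γ) = ∑ᶠ p, G p := by
    rw [← finsum_comp_equiv σ, finsum_curry _ (hGf.preimage σ.injective.injOn)]
    refine finsum_congr fun γ => ?_
    rw [coeff_ofReversed, mul_finsum]
    refine finsum_congr fun δ => ?_
    have e1 : Exponent.diag (fun s => γ s + δ s) = Exponent.diag γ + Exponent.diag δ :=
      Exponent.diag_add γ δ
    have e2 : (fun s => (u + Exponent.diag (fun s => γ s + δ s)).x s - (δ s : ℤ)) =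
        (u + Exponent.diag γ).x := by
      funext s
      simp
      ring
    change _ = (leibnizCoeff (u + Exponent.diag (fun s => γ s + δ s)).d
        (u + Exponent.diag (fun s => γ s + δ s)).x δ *
      leibnizCoeff e.d (fun s => (u + Exponent.diag (fun s => γ s + δ s)).x s - (δ s)) γ : ℤ) *
      V.coeff (u + Exponent.diag (fun s => γ s + δ s))
    rw [e2, e1, add_assoc]
    push_cast
    ring
  rw [h1, finsum_eq_sum_of_support_subset _ hG, Finset.sum_biUnion]
  · have h2 : ∀ ε : Fin n → ℕ, ∑ p ∈ splittings ε, G p =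
        (leibnizCoeff (fun s => e.d s + (u + Exponent.diag ε).d s) (u + Exponent.diag ε).x ε : k) *
          V.coeff (u + Exponent.diag ε) := by
      intro ε
      rw [← sum_splittings_leibnizCoeff, Int.cast_sum, Finset.sum_mul]
      refine Finset.sum_congr rfl fun p hp => ?_
      have : (fun s => (p s).1 + (p s).2) = ε := funext fun s =>
        Finset.HasAntidiagonal.mem_antidiagonal.1 (Fintype.mem_piFinset.1 hp s)
      simp only [G, this]
    rw [Finset.sum_congr rfl fun ε _ => h2 ε, Finset.sum_eq_single 0]
    · have h0 : Exponent.diag (0 : Fin n → ℕ) = 0 := rfl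
      simp [leibnizCoeff_zero, h0]
    · intro ε _ hε
      rw [leibnizCoeff_eq_zero _ _ hε, Int.cast_zero, zero_mul]
      intro s
      simp [hu]
      ring
    · intro h
      have h3 : V.coeff (u + Exponent.diag 0) = 0 := by
        by_contra h3
        exact h (hE.mem_toFinset.2 h3)
      rw [h3, mul_zero]
  · intro ε _ ε' _ hne
    refine Finset.disjoint_left.2 fun p hp hp' => hne (funext fun s => ?_)
    rw [← Finset.HasAntidiagonal.mem_antidiagonal.1 (Fintype.mem_piFinset.1 hp s),
      ← Finset.HasAntidiagonal.mem_antidiagonal.1 (Fintype.mem_piFinset.1 hp' s)]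

theorem res_mul_eq_finsum (M U : PsiDO n k) :
    (M * U).res = ∑ᶠ e, M.coeff e *
      ∑ᶠ γ : Fin n → ℕ, (leibnizCoeff e.d (-Exponent.diag 1 - e + Exponent.diag γ).x γ : k) *
        U.coeff (-Exponent.diag 1 - e + Exponent.diag γ) := by
  have hinj : Function.Injective fun q : Exponent n × (Fin n → ℕ) =>
      (q.1, -Exponent.diag 1 - q.1 + Exponent.diag q.2, q.2) := by
    rintro ⟨e, γ⟩ ⟨e', γ'⟩ h
    simp only [Prod.mk.injEq] at h
    exact Prod.ext h.1 h.2.2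
  have hsub : Function.support (mulTerm M U (-Exponent.diag 1)) ⊆
      Set.range fun q : Exponent n × (Fin n → ℕ) =>
        (q.1, -Exponent.diag 1 - q.1 + Exponent.diag q.2, q.2) := by
    rintro ⟨e, f, γ⟩ h
    have := (support_mulTerm _ _ _ h).2.2
    simp only at this
    refine ⟨(e, γ), ?_⟩
    simp only [Prod.mk.injEq, true_and, and_true]
    rw [← this]
    abel
  have hfin : (Function.support (mulTerm M U (-Exponent.diag 1))).Finite :=
    (finite_contributions M.isPWO_support U.isPWO_support _).subset (support_mulTerm _ _ _)
  rw [res, coeff_mul, ← finsum_mem_univ, ← finsum_mem_inter_support, Set.univ_inter,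
    ← Set.inter_eq_right.2 hsub, finsum_mem_inter_support, finsum_mem_range hinj,
    finsum_curry _ (hfin.preimage hinj.injOn)]
  refine finsum_congr fun e => ?_
  rw [mul_finsum]
  refine finsum_congr fun γ => ?_
  rw [mulTerm, if_pos]
  · ring
  · simp only
    abel

/-- Every linear functional whose coefficients are supported on a set with the opposite
well-ordering is represented by an operator. -/
theorem exists_forall_res_mul_eq {a : Exponent n → k}
    (ha : {e | a (-Exponent.diag 1 - e) ≠ 0}.IsPWO) :
    ∃ U : PsiDO n k, ∀ M : PsiDO n k, (M * U).res = ∑ᶠ e, M.coeff e * a e := by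
  refine ⟨ofReversed (mk (fun e => a (-Exponent.diag 1 - e)) ha), fun M => ?_⟩
  rw [res_mul_eq_finsum]
  refine finsum_congr fun e => ?_
  rw [finsum_leibnizCoeff_ofReversed, coeff_mk, sub_sub_cancel]

/-- The residue pairing is nondegenerate. -/
theorem eq_of_forall_res_mul_eq {U V : PsiDO n k}
    (h : ∀ M : PsiDO n k, (M * U).res = (M * V).res) : U = V := by
  classical
  ext e
  obtain ⟨W, hW⟩ := exists_forall_res_mul_eq (n := n) (k := k) (a := Pi.single e 1)
    ((Set.finite_singleton (-Exponent.diag 1 - e)).isPWO.mono fun f hf => by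
      by_contra h'
      refine hf (Pi.single_eq_of_ne (fun h'' => h' ?_) _)
      rw [Set.mem_singleton_iff, ← h'', sub_sub_cancel])
  have key : ∀ M : PsiDO n k, (W * M).res = M.coeff e := by
    intro M
    rw [res_mul_comm, hW, finsum_eq_single _ e]
    · simp
    · intro f hf
      rw [Pi.single_eq_of_ne hf, mul_zero]
  rw [← key, ← key, h]

end PsiDO

theorem Exponent.isPWO_of_forall_finite_inter {n : ℕ} {A : Set (Exponent n)}
    (hA : ∀ T : Set (Exponent n), T.IsPWO → (A ∩ T).Finite) (g : Exponent n) :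
    {e | g - e ∈ A}.IsPWO := by
  refine Set.IsWF.isPWO (Set.isWF_iff_no_descending_seq.2 fun f hf hmem => ?_)
  have hmono : StrictMono fun i => g - f i := fun i j hij => sub_lt_sub_left (hf hij) g
  have hT : (Set.range fun i => g - f i).IsPWO := by
    rw [← Set.image_univ]
    exact (Set.isPWO_of_wellQuasiOrderedLE _).image_of_monotone hmono.monotone
  refine Set.infinite_range_of_injective hmono.injective ((hA _ hT).subset ?_)
  rintro _ ⟨i, rfl⟩
  exact ⟨hmem i, i, rfl⟩

namespace PhaseSpace

variable {n : ℕ} {k : Type*} [Field k]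

/-- The sets of variables that occur as supports of points of `Pⁿ`. -/
def IsAdmissible (W : Set (Fin n × Exponent n)) : Prop := ∀ i, {e | (i, e) ∈ W}.IsPWO

/-- The coefficients that do not vanish at a point of `Pⁿ`. -/
def support (L : PhaseSpace n k) : Set (Fin n × Exponent n) := {v | (L v.1).coeff v.2 ≠ 0}

theorem isAdmissible_support (L : PhaseSpace n k) : IsAdmissible L.support :=
  fun i => (L i).isPWO_support

theorem IsAdmissible.union {W W' : Set (Fin n × Exponent n)} (h : IsAdmissible W)
    (h' : IsAdmissible W') : IsAdmissible (W ∪ W') :=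
  fun i => (h i).union (h' i)

theorem isAdmissible_prod (i : Fin n) {T : Set (Exponent n)} (hT : T.IsPWO) :
    IsAdmissible (({i} : Set (Fin n)) ×ˢ T) :=
  fun _ => hT.mono fun _ he => he.2

theorem coordMonomial_ne_zero {L : PhaseSpace n k} {μ : Fin n × Exponent n →₀ ℕ} :
    L.coordMonomial μ ≠ 0 ↔ (μ.support : Set _) ⊆ L.support := by
  rw [coordMonomial, Finsupp.prod, Finset.prod_ne_zero_iff]
  refine forall₂_congr fun v hv => ?_
  exact pow_ne_zero_iff (Finsupp.mem_support_iff.1 hv)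

theorem coordMonomial_zero (L : PhaseSpace n k) : L.coordMonomial 0 = 1 := Finsupp.prod_zero_index

theorem coordMonomial_single (L : PhaseSpace n k) (v : Fin n × Exponent n) :
    L.coordMonomial (Finsupp.single v 1) = (L v.1).coeff v.2 := by
  simp [coordMonomial]

theorem coordMonomial_add (L : PhaseSpace n k) (μ ν : Fin n × Exponent n →₀ ℕ) :
    L.coordMonomial (μ + ν) = L.coordMonomial μ * L.coordMonomial ν := by
  classical
  exact Finsupp.prod_add_index' (fun _ => pow_zero _) fun _ _ _ => pow_add _ _ _

/-- Every admissible set of variables is the support of a point of `Pⁿ`. -/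
theorem exists_support_eq (k : Type*) [Field k] {W : Set (Fin n × Exponent n)}
    (hW : IsAdmissible W) : ∃ L : PhaseSpace n k, L.support = W := by
  classical
  refine ⟨fun i => PsiDO.mk (fun e => if (i, e) ∈ W then 1 else 0) ((hW i).mono fun e he => ?_), ?_⟩
  · by_contra h
    exact he (if_neg h)
  · ext ⟨i, e⟩
    simp [support]

theorem IsGivenBy.finite_of_isAdmissible {F : PhaseSpace n k → k}
    {c : (Fin n × Exponent n →₀ ℕ) → k} (h : IsGivenBy F c) {W : Set (Fin n × Exponent n)}
    (hW : IsAdmissible W) : {μ | c μ ≠ 0 ∧ (μ.support : Set _) ⊆ W}.Finite := by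
  obtain ⟨L, rfl⟩ := exists_support_eq k hW
  exact (h.finite_support L).subset fun μ hμ => mul_ne_zero hμ.1 (coordMonomial_ne_zero.2 hμ.2)

/-- The partial derivative at `L` of a formal polynomial with respect to a coefficient. -/
def partialDeriv (c : (Fin n × Exponent n →₀ ℕ) → k) (L : PhaseSpace n k)
    (v : Fin n × Exponent n) : k :=
  ∑ᶠ μ : Fin n × Exponent n →₀ ℕ, c μ * (μ v * L.coordMonomial (μ - Finsupp.single v 1))

theorem support_subset_of_tsub_single {W : Set (Fin n × Exponent n)}
    {μ : Fin n × Exponent n →₀ ℕ} {v : Fin n × Exponent n} (hv : v ∈ W)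
    (h : ((μ - Finsupp.single v 1).support : Set _) ⊆ W) : (μ.support : Set _) ⊆ W := by
  intro w hw
  by_cases hwv : w = v
  · exact hwv ▸ hv
  · refine h (Finset.mem_coe.2 (Finsupp.mem_support_iff.2 ?_))
    rw [Finsupp.tsub_apply, Finsupp.single_eq_of_ne hwv, tsub_zero]
    exact Finsupp.mem_support_iff.1 hw

theorem ne_zero_of_partialDeriv_term_ne_zero {c : (Fin n × Exponent n →₀ ℕ) → k}
    {L : PhaseSpace n k} {μ : Fin n × Exponent n →₀ ℕ} {v : Fin n × Exponent n}
    (h : c μ * (μ v * L.coordMonomial (μ - Finsupp.single v 1)) ≠ 0)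
    {W : Set (Fin n × Exponent n)} (hL : L.support ⊆ W) (hv : v ∈ W) :
    (c μ ≠ 0 ∧ (μ.support : Set _) ⊆ W) ∧ v ∈ μ.support := by
  refine ⟨⟨left_ne_zero_of_mul h, support_subset_of_tsub_single hv
    ((coordMonomial_ne_zero.1 (right_ne_zero_of_mul (right_ne_zero_of_mul h))).trans hL)⟩, ?_⟩
  refine Finsupp.mem_support_iff.2 fun h0 => h ?_
  simp [h0]

theorem IsGivenBy.finite_partialDeriv {F : PhaseSpace n k → k}
    {c : (Fin n × Exponent n →₀ ℕ) → k} (h : IsGivenBy F c) (L : PhaseSpace n k)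
    {W : Set (Fin n × Exponent n)} (hW : IsAdmissible W) :
    ({v | partialDeriv c L v ≠ 0} ∩ W).Finite := by
  classical
  have hS := h.finite_of_isAdmissible (L.isAdmissible_support.union hW)
  refine (hS.toFinset.biUnion Finsupp.support).finite_toSet.subset ?_
  rintro v ⟨hv, hvW⟩
  obtain ⟨μ, hμ⟩ : ∃ μ, c μ * (μ v * L.coordMonomial (μ - Finsupp.single v 1)) ≠ 0 := by
    by_contra! h'
    exact hv (finsum_eq_zero_of_forall_eq_zero h')
  have := ne_zero_of_partialDeriv_term_ne_zero hμ Set.subset_union_left (Or.inr hvW)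
  exact Finset.mem_coe.2 (Finset.mem_biUnion.2 ⟨μ, hS.mem_toFinset.2 this.1, this.2⟩)

/-- The restriction of a monomial to the line `ε ↦ L + ε M`. -/
def lineMonomial (L M : PhaseSpace n k) (μ : Fin n × Exponent n →₀ ℕ) : Polynomial k :=
  μ.prod fun v r => (Polynomial.C ((L v.1).coeff v.2) +
    Polynomial.C ((M v.1).coeff v.2) * Polynomial.X) ^ r

theorem eval_lineMonomial (L M : PhaseSpace n k) (μ : Fin n × Exponent n →₀ ℕ) (ε : k) :
    (lineMonomial L M μ).eval ε = (L + ε • M).coordMonomial μ := by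
  rw [lineMonomial, coordMonomial, Finsupp.prod, Finsupp.prod, Polynomial.eval_prod]
  refine Finset.prod_congr rfl fun v _ => ?_
  rw [Polynomial.eval_pow, Polynomial.eval_add, Polynomial.eval_mul, Polynomial.eval_C,
    Polynomial.eval_C, Polynomial.eval_X, Pi.add_apply, Pi.smul_apply, PsiDO.coeff_add,
    PsiDO.coeff_smul, mul_comm ε]

theorem eval_derivative_lineMonomial (L M : PhaseSpace n k) (μ : Fin n × Exponent n →₀ ℕ) :
    (lineMonomial L M μ).derivative.eval 0 =
      ∑ v ∈ μ.support, (M v.1).coeff v.2 * (μ v * L.coordMonomial (μ - Finsupp.single v 1)) := by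
  classical
  rw [lineMonomial, Finsupp.prod, Polynomial.derivative_prod_finset, Polynomial.eval_finsetSum]
  refine Finset.sum_congr rfl fun v hv => ?_
  have h1 : L.coordMonomial (μ - Finsupp.single v 1) =
      (L v.1).coeff v.2 ^ (μ v - 1) * ∏ w ∈ μ.support.erase v, (L w.1).coeff w.2 ^ μ w := by
    rw [coordMonomial, Finsupp.prod_of_support_subset (s := μ.support) _ ?_ _
      (fun _ _ => pow_zero _), ← Finset.mul_prod_erase _ _ hv]
    · congr 1
      · simp
      · refine Finset.prod_congr rfl fun w hw => ?_
        rw [Finsupp.tsub_apply, Finsupp.single_eq_of_ne (Finset.ne_of_mem_erase hw), tsub_zero]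
    · intro w hw
      refine Finsupp.mem_support_iff.2 fun h0 => Finsupp.mem_support_iff.1 hw ?_
      rw [Finsupp.tsub_apply, h0, zero_tsub]
  rw [h1]
  simp [Polynomial.eval_prod, Polynomial.derivative_pow]
  ring

theorem IsGivenBy.hasDirDeriv {F : PhaseSpace n k → k} {c : (Fin n × Exponent n →₀ ℕ) → k}
    (h : IsGivenBy F c) (L M : PhaseSpace n k) :
    HasDirDeriv F L M (∑ᶠ v : Fin n × Exponent n, (M v.1).coeff v.2 * partialDeriv c L v) := by
  classical
  have hW := L.isAdmissible_support.union M.isAdmissible_support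
  have hS := h.finite_of_isAdmissible hW
  refine ⟨∑ μ ∈ hS.toFinset, Polynomial.C (c μ) * lineMonomial L M μ, fun ε => ?_, ?_⟩
  · rw [h.eq_finsum, Polynomial.eval_finsetSum, finsum_eq_sum_of_support_subset (s := hS.toFinset)]
    · refine Finset.sum_congr rfl fun μ _ => ?_
      rw [Polynomial.eval_mul, Polynomial.eval_C, eval_lineMonomial]
    · intro μ hμ
      refine Finset.mem_coe.2 (hS.mem_toFinset.2 ⟨left_ne_zero_of_mul hμ,
        (coordMonomial_ne_zero.1 (right_ne_zero_of_mul hμ)).trans fun v hv => ?_⟩)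
      by_contra h'
      simp only [support, Set.mem_union, Set.mem_ofPred_eq, not_or, not_not] at h'
      exact hv (by simp [h'.1, h'.2])
  · have h1 : ∀ v ∈ M.support, partialDeriv c L v = ∑ μ ∈ hS.toFinset,
        c μ * (μ v * L.coordMonomial (μ - Finsupp.single v 1)) := by
      intro v hv
      refine finsum_eq_sum_of_support_subset _ fun μ hμ => ?_
      exact Finset.mem_coe.2 (hS.mem_toFinset.2
        (ne_zero_of_partialDeriv_term_ne_zero hμ Set.subset_union_left (Or.inr hv)).1)
    have h2 : ∀ v, (M v.1).coeff v.2 * partialDeriv c L v = ∑ μ ∈ hS.toFinset,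
        c μ * ((M v.1).coeff v.2 * (μ v * L.coordMonomial (μ - Finsupp.single v 1))) := by
      intro v
      by_cases hv : v ∈ M.support
      · rw [h1 v hv, Finset.mul_sum]
        exact Finset.sum_congr rfl fun μ _ => by ring
      · have : (M v.1).coeff v.2 = 0 := not_not.1 hv
        simp [this]
    rw [finsum_eq_sum_of_support_subset (s := hS.toFinset.biUnion Finsupp.support),
      Finset.sum_congr rfl fun v _ => h2 v, Finset.sum_comm, Polynomial.derivative_sum,
      Polynomial.eval_finsetSum]
    · refine Finset.sum_congr rfl fun μ hμ => ?_
      rw [Polynomial.derivative_C_mul, Polynomial.eval_C_mul, eval_derivative_lineMonomial,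
        Finset.mul_sum]
      refine Finset.sum_subset (Finset.subset_biUnion_of_mem _ hμ) fun v _ hv => ?_
      rw [Finsupp.notMem_support_iff.1 hv]
      simp
    · intro v hv
      have hvM : v ∈ M.support := left_ne_zero_of_mul hv
      have hv' := right_ne_zero_of_mul hv
      rw [h1 v hvM] at hv'
      obtain ⟨μ, hμ, hμv⟩ := Finset.exists_ne_zero_of_sum_ne_zero hv'
      exact Finset.mem_coe.2 (Finset.mem_biUnion.2 ⟨μ, hμ,
        (ne_zero_of_partialDeriv_term_ne_zero hμv Set.subset_union_left (Or.inr hvM)).2⟩)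

theorem exists_isGradient {F : PhaseSpace n k → k} (hF : F ∈ functionals n k)
    (L : PhaseSpace n k) : ∃ U, IsGradient F L U := by
  obtain ⟨c, h⟩ := hF
  have h1 : ∀ i, ∃ U : PsiDO n k, ∀ M : PsiDO n k,
      (M * U).res = ∑ᶠ e, M.coeff e * partialDeriv c L (i, e) := by
    intro i
    refine PsiDO.exists_forall_res_mul_eq (Exponent.isPWO_of_forall_finite_inter
      (A := {e | partialDeriv c L (i, e) ≠ 0}) (fun T hT => ?_) _)
    refine ((h.finite_partialDeriv L (isAdmissible_prod i hT)).preimage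
      (Prod.mk_right_injective i).injOn).subset fun e he => ?_
    exact ⟨he.1, rfl, he.2⟩
  choose U hU using h1
  refine ⟨U, fun M => ?_⟩
  convert h.hasDirDeriv L M using 1
  rw [finsum_curry, finsum_eq_sum_of_fintype]
  · exact Finset.sum_congr rfl fun i _ => hU i (M i)
  · refine (h.finite_partialDeriv L M.isAdmissible_support).subset fun v hv => ?_
    exact ⟨right_ne_zero_of_mul hv, left_ne_zero_of_mul hv⟩

theorem HasDirDeriv.unique [CharZero k] {F : PhaseSpace n k → k} {L M : PhaseSpace n k} {a b : k}
    (ha : HasDirDeriv F L M a) (hb : HasDirDeriv F L M b) : a = b := by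
  obtain ⟨p, hp, rfl⟩ := ha
  obtain ⟨q, hq, rfl⟩ := hb
  rw [Polynomial.funext fun ε => (hp ε).symm.trans (hq ε)]

theorem pairing_single (i : Fin n) (M : PsiDO n k) (U : PhaseSpace n k) :
    pairing (Pi.single i M) U = (M * U i).res := by
  classical
  rw [pairing, Finset.sum_eq_single i]
  · simp
  · intro j _ hj
    simp [hj]
  · simp

theorem IsGradient.unique [CharZero k] {F : PhaseSpace n k → k} {L U V : PhaseSpace n k}
    (hU : IsGradient F L U) (hV : IsGradient F L V) : U = V := by
  funext i
  refine PsiDO.eq_of_forall_res_mul_eq fun M => ?_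
  rw [← pairing_single, ← pairing_single]
  exact (hU _).unique (hV _)

theorem existsUnique_isGradient [CharZero k] {F : PhaseSpace n k → k} (hF : F ∈ functionals n k)
    (L : PhaseSpace n k) : ∃! U, IsGradient F L U :=
  (exists_isGradient hF L).imp fun _ hU => ⟨hU, fun _ hV => hV.unique hU⟩

theorem isGradient_gradient {F : PhaseSpace n k → k} (hF : F ∈ functionals n k)
    (L : PhaseSpace n k) : IsGradient F L (gradient F L) := by
  have h := exists_isGradient hF L
  rw [gradient, dif_pos h]
  exact h.choose_spec

theorem coeff_mem_functionals (i : Fin n) (e : Exponent n) :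
    (fun L : PhaseSpace n k => (L i).coeff e) ∈ functionals n k := by
  classical
  have h : ∀ (L : PhaseSpace n k) (μ : Fin n × Exponent n →₀ ℕ), μ ≠ Finsupp.single (i, e) 1 →
      (Pi.single (Finsupp.single (i, e) 1) 1 : (Fin n × Exponent n →₀ ℕ) → k) μ *
        L.coordMonomial μ = 0 := by
    intro L μ hμ
    rw [Pi.single_eq_of_ne hμ, zero_mul]
  refine ⟨Pi.single (Finsupp.single (i, e) 1) 1, ⟨1, fun μ hμ => ?_⟩, fun L => ?_, fun L => ?_⟩
  · by_cases h' : μ = Finsupp.single (i, e) 1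
    · rw [h', Finsupp.degree_single]
    · exact absurd (Pi.single_eq_of_ne h' _) hμ
  · exact (Set.finite_singleton _).subset fun μ hμ => by_contra fun h' => hμ (h L μ h')
  · rw [finsum_eq_single _ _ (h L), Pi.single_eq_same, one_mul, coordMonomial_single]

open Classical in
/-- The operator valued function `Φ` is given by the family of terms `w x • μ(L) • x ^ i ∂ ^ j`,
indexed by `x`, with `μ = d x` and `(i, j) = g x`. -/
structure IsExpansion {ι : Type} (Φ : PhaseSpace n k → PsiDO n k) (w : ι → k)
    (d : ι → Fin n × Exponent n →₀ ℕ) (g : ι → Exponent n) : Prop where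
  bounded_degree : ∃ N : ℕ, ∀ x, w x ≠ 0 → (d x).degree ≤ N
  isPWO : ∀ W : Set (Fin n × Exponent n), IsAdmissible W →
    (g '' {x | w x ≠ 0 ∧ ((d x).support : Set _) ⊆ W}).IsPWO
  finite : ∀ W : Set (Fin n × Exponent n), IsAdmissible W → ∀ e,
    {x | (w x ≠ 0 ∧ ((d x).support : Set _) ⊆ W) ∧ g x = e}.Finite
  coeff_eq : ∀ L e, (Φ L).coeff e = ∑ᶠ x, if g x = e then w x * L.coordMonomial (d x) else 0

/-- The operator valued function `Φ` is polynomial in the coefficients of `L₁, …, Lₙ`. -/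
def IsPolynomial (Φ : PhaseSpace n k → PsiDO n k) : Prop :=
  ∃ (ι : Type) (w : ι → k) (d : ι → Fin n × Exponent n →₀ ℕ) (g : ι → Exponent n),
    IsExpansion Φ w d g

namespace IsExpansion

variable {ι κ : Type} {Φ Ψ : PhaseSpace n k → PsiDO n k} {w : ι → k}
  {d : ι → Fin n × Exponent n →₀ ℕ} {g : ι → Exponent n} {w' : κ → k}
  {d' : κ → Fin n × Exponent n →₀ ℕ} {g' : κ → Exponent n}

open Classical in
theorem support_term_subset (w : ι → k) (d : ι → Fin n × Exponent n →₀ ℕ) (g : ι → Exponent n)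
    (L : PhaseSpace n k) (e : Exponent n) :
    (Function.support fun x => if g x = e then w x * L.coordMonomial (d x) else 0) ⊆
      {x | (w x ≠ 0 ∧ ((d x).support : Set _) ⊆ L.support) ∧ g x = e} := by
  intro x hx
  simp only [Function.mem_support, ne_eq, ite_eq_right_iff, not_forall] at hx
  obtain ⟨hg, hx⟩ := hx
  exact ⟨⟨left_ne_zero_of_mul hx, coordMonomial_ne_zero.1 (right_ne_zero_of_mul hx)⟩, hg⟩

open Classical in
theorem finite_support_term (h : IsExpansion Φ w d g) (L : PhaseSpace n k) (e : Exponent n) :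
    (Function.support fun x => if g x = e then w x * L.coordMonomial (d x) else 0).Finite :=
  (h.finite _ L.isAdmissible_support e).subset (support_term_subset w d g L e)

theorem coeff_mem_functionals (h : IsExpansion Φ w d g) (e : Exponent n) :
    (fun L => (Φ L).coeff e) ∈ functionals n k := by
  classical
  obtain ⟨N, hN⟩ := h.bounded_degree
  have key : ∀ μ, (∑ᶠ x, if d x = μ then (if g x = e then w x else 0) else 0) ≠ 0 →
      ∃ x, d x = μ ∧ g x = e ∧ w x ≠ 0 := by
    intro μ hμ
    by_contra! h'
    refine hμ (finsum_eq_zero_of_forall_eq_zero fun x => ?_)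
    split_ifs with h1 h2
    · exact h' x h1 h2
    · rfl
    · rfl
  refine ⟨fun μ => ∑ᶠ x, if d x = μ then (if g x = e then w x else 0) else 0,
    ⟨N, fun μ hμ => ?_⟩, fun L => ?_, fun L => ?_⟩
  · obtain ⟨x, rfl, -, hx⟩ := key μ hμ
    exact hN x hx
  · refine ((h.finite _ L.isAdmissible_support e).image d).subset fun μ hμ => ?_
    obtain ⟨x, rfl, hg, hx⟩ := key μ (left_ne_zero_of_mul hμ)
    exact ⟨x, ⟨⟨hx, coordMonomial_ne_zero.1 (right_ne_zero_of_mul hμ)⟩, hg⟩, rfl⟩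
  · rw [h.coeff_eq, finsum_fiberwise d (h.finite_support_term L e)]
    refine finsum_congr fun μ => ?_
    rw [finsum_mul]
    refine finsum_congr fun x => ?_
    split_ifs with h1 h2
    · rw [h1]
    · rw [zero_mul]
    · rw [zero_mul]

open scoped Pointwise in
theorem mul (h : IsExpansion Φ w d g) (h' : IsExpansion Ψ w' d' g') :
    IsExpansion (fun L => Φ L * Ψ L)
      (fun q : ι × κ × (Fin n → ℕ) =>
        (leibnizCoeff (g q.1).d (g' q.2.1).x q.2.2 : k) * (w q.1 * w' q.2.1))
      (fun q => d q.1 + d' q.2.1)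
      (fun q => g q.1 + g' q.2.1 - Exponent.diag q.2.2) := by
  classical
  have hsub : ∀ {W : Set (Fin n × Exponent n)} {q : ι × κ × (Fin n → ℕ)},
      (leibnizCoeff (g q.1).d (g' q.2.1).x q.2.2 : k) * (w q.1 * w' q.2.1) ≠ 0 ∧
        ((d q.1 + d' q.2.1).support : Set _) ⊆ W →
      (w q.1 ≠ 0 ∧ ((d q.1).support : Set _) ⊆ W) ∧
        (w' q.2.1 ≠ 0 ∧ ((d' q.2.1).support : Set _) ⊆ W) := by
    rintro W q ⟨h1, h2⟩
    refine ⟨⟨left_ne_zero_of_mul (right_ne_zero_of_mul h1), fun v hv => h2 ?_⟩,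
      ⟨right_ne_zero_of_mul (right_ne_zero_of_mul h1), fun v hv => h2 ?_⟩⟩
    all_goals
      have := Finsupp.mem_support_iff.1 hv
      refine Finset.mem_coe.2 (Finsupp.mem_support_iff.2 ?_)
      rw [Finsupp.add_apply]
      omega
  have hfin : ∀ W : Set (Fin n × Exponent n), IsAdmissible W → ∀ e, {q : ι × κ × (Fin n → ℕ) |
      ((leibnizCoeff (g q.1).d (g' q.2.1).x q.2.2 : k) * (w q.1 * w' q.2.1) ≠ 0 ∧
        ((d q.1 + d' q.2.1).support : Set _) ⊆ W) ∧
      g q.1 + g' q.2.1 - Exponent.diag q.2.2 = e}.Finite := by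
    intro W hW e
    have hK := PsiDO.finite_contributions (h.isPWO W hW) (h'.isPWO W hW) e
    refine (hK.biUnion fun t _ => (h.finite W hW t.1).prod
      ((h'.finite W hW t.2.1).prod (Set.finite_singleton t.2.2))).subset ?_
    rintro ⟨x, y, γ⟩ ⟨hq, he⟩
    obtain ⟨hx, hy⟩ := hsub hq
    exact Set.mem_biUnion (x := (g x, g' y, γ)) ⟨⟨x, hx, rfl⟩, ⟨y, hy, rfl⟩, he⟩
      ⟨⟨hx, rfl⟩, ⟨hy, rfl⟩, rfl⟩
  refine ⟨?_, fun W hW => ?_, hfin, fun L e => ?_⟩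
  · obtain ⟨N, hN⟩ := h.bounded_degree
    obtain ⟨N', hN'⟩ := h'.bounded_degree
    refine ⟨N + N', fun q hq => ?_⟩
    rw [map_add]
    exact add_le_add (hN _ (left_ne_zero_of_mul (right_ne_zero_of_mul hq)))
      (hN' _ (right_ne_zero_of_mul (right_ne_zero_of_mul hq)))
  · refine (((h.isPWO W hW).add (h'.isPWO W hW)).add Exponent.isPWO_range_neg_diag).mono ?_
    rintro _ ⟨q, hq, rfl⟩
    obtain ⟨hx, hy⟩ := hsub hq
    exact ⟨g q.1 + g' q.2.1, Set.add_mem_add ⟨_, hx, rfl⟩ ⟨_, hy, rfl⟩, _, ⟨q.2.2, rfl⟩,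
      (sub_eq_add_neg _ _).symm⟩
  · rw [finsum_fiberwise (fun q : ι × κ × (Fin n → ℕ) => (g q.1, g' q.2.1, q.2.2))
      ((hfin _ L.isAdmissible_support e).subset (support_term_subset _ _ _ L e)), PsiDO.coeff_mul]
    refine finsum_congr fun ⟨e₁, e₂, γ⟩ => ?_
    rw [PsiDO.mulTerm]
    split_ifs with he
    · simp only at he ⊢
      rw [h.coeff_eq, h'.coeff_eq, finsum_mul_finsum_prod (h.finite_support_term L e₁)
        (h'.finite_support_term L e₂), mul_finsum]
      have hinj : Function.Injective fun q : ι × κ => (q.1, q.2, γ) := by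
        rintro ⟨x, y⟩ ⟨x', y'⟩ hq
        simp only [Prod.mk.injEq, and_true] at hq
        exact Prod.ext hq.1 hq.2
      rw [← finsum_mem_range hinj (f := fun q : ι × κ × (Fin n → ℕ) =>
        (leibnizCoeff e₁.d e₂.x γ : k) *
          ((if g q.1 = e₁ then w q.1 * L.coordMonomial (d q.1) else 0) *
          (if g' q.2.1 = e₂ then w' q.2.1 * L.coordMonomial (d' q.2.1) else 0)))]
      refine finsum_congr fun ⟨x, y, γ'⟩ => ?_
      by_cases hγ : γ' = γ
      · subst hγ
        rw [finsum_eq_if, if_pos ⟨(x, y), rfl⟩]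
        simp only [Prod.mk.injEq, and_true]
        by_cases h1 : g x = e₁
        · by_cases h2 : g' y = e₂
          · subst h1 h2
            simp only [he, coordMonomial_add, and_self, if_true]
            ring
          · simp [h2]
        · simp [h1]
      · rw [finsum_eq_if, if_neg, if_neg]
        · simp [hγ]
        · rintro ⟨q, hq⟩
          simp only [Prod.mk.injEq] at hq
          exact hγ hq.2.2.symm
    · symm
      refine finsum_eq_zero_of_forall_eq_zero fun ⟨x, y, γ'⟩ => ?_
      simp only [Prod.mk.injEq]
      split_ifs with h1 h2
      · obtain ⟨rfl, rfl, rfl⟩ := h1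
        exact absurd h2 he
      · rfl
      · rfl

end IsExpansion

theorem IsPolynomial.mul {Φ Ψ : PhaseSpace n k → PsiDO n k} (h : IsPolynomial Φ)
    (h' : IsPolynomial Ψ) : IsPolynomial fun L => Φ L * Ψ L := by
  obtain ⟨ι, w, d, g, h⟩ := h
  obtain ⟨κ, w', d', g', h'⟩ := h'
  exact ⟨_, _, _, _, h.mul h'⟩

theorem isPolynomial_one : IsPolynomial fun _ : PhaseSpace n k => (1 : PsiDO n k) := by
  classical
  refine ⟨Unit, fun _ => 1, fun _ => 0, fun _ => 0, ⟨0, by simp⟩, fun W _ => ?_,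
    fun W _ e => Set.toFinite _, fun L e => ?_⟩
  · exact (Set.toFinite _).isPWO
  · rw [finsum_eq_single _ () (by simp), PsiDO.coeff_one, coordMonomial_zero, mul_one]
    simp only [eq_comm]

theorem isPolynomial_apply (i : Fin n) : IsPolynomial fun L : PhaseSpace n k => L i := by
  classical
  refine ⟨Exponent n, fun _ => 1, fun e => Finsupp.single (i, e) 1, id, ⟨1, fun e _ => ?_⟩,
    fun W hW => ?_, fun W hW e => ?_, fun L e => ?_⟩
  · rw [Finsupp.degree_single]
  · refine (hW i).mono ?_
    rintro _ ⟨e, he, rfl⟩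
    exact he.2 (by simp)
  · exact (Set.finite_singleton e).subset fun f hf => hf.2
  · simp only [id]
    rw [finsum_eq_single _ e fun f hf => if_neg hf]
    simp [coordMonomial_single]

theorem IsPolynomial.pow {Φ : PhaseSpace n k → PsiDO n k} (h : IsPolynomial Φ) (r : ℕ) :
    IsPolynomial fun L => Φ L ^ r := by
  induction r with
  | zero => simpa using isPolynomial_one
  | succ r ih => simpa only [pow_succ] using ih.mul h

theorem isPolynomial_list_prod {α : Type*} {Φ : α → PhaseSpace n k → PsiDO n k}
    (h : ∀ a, IsPolynomial (Φ a)) (l : List α) :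
    IsPolynomial fun L => (l.map fun a => Φ a L).prod := by
  induction l with
  | nil => simpa using isPolynomial_one
  | cons a l ih => simpa only [List.map_cons, List.prod_cons] using (h a).mul ih

theorem monomial_eq_prod_map (L : PhaseSpace n k) (m : Fin n → ℕ) :
    L.monomial m = ((List.finRange n).map fun i => L i ^ m i).prod := by
  rw [monomial, List.ofFn_eq_map]

theorem hamiltonian_mem_functionals (m : Fin n → ℕ) : hamiltonian m ∈ functionals n k := by
  obtain ⟨ι, w, d, g, h⟩ := isPolynomial_list_prod (k := k)
    (fun i : Fin n => (isPolynomial_apply i).pow (m i)) (List.finRange n)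
  have := h.coeff_mem_functionals (-Exponent.diag 1)
  simp only [← monomial_eq_prod_map] at this
  exact this

end PhaseSpace

namespace PsiDO

variable {n : ℕ} {k : Type*} [Field k]

/-- The evaluation of a polynomial with coefficients in `P` at a scalar. -/
def evalScalar (ε : k) : Polynomial (PsiDO n k) →+* PsiDO n k :=
  Polynomial.eval₂RingHom' (RingHom.id _) (ε • (1 : PsiDO n k)) fun A =>
    (Commute.one_right (RingHom.id _ A)).smul_right ε

theorem evalScalar_apply (ε : k) (q : Polynomial (PsiDO n k)) :
    evalScalar ε q = ∑ j ∈ Finset.range (q.natDegree + 1), ε ^ j • q.coeff j := by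
  rw [evalScalar, Polynomial.eval₂RingHom'_apply, Polynomial.eval₂_eq_sum_range]
  refine Finset.sum_congr rfl fun j _ => ?_
  rw [RingHom.id_apply, smul_pow, one_pow, mul_smul_comm, mul_one]

theorem evalScalar_line (ε : k) (A B : PsiDO n k) :
    evalScalar ε (Polynomial.C A + Polynomial.C B * Polynomial.X) = A + ε • B := by
  rw [map_add, map_mul]
  simp [evalScalar]

/-- The residue, coefficient by coefficient. -/
def resPolynomial (q : Polynomial (PsiDO n k)) : Polynomial k :=
  ∑ j ∈ Finset.range (q.natDegree + 1), Polynomial.monomial j (q.coeff j).res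

theorem eval_resPolynomial (ε : k) (q : Polynomial (PsiDO n k)) :
    (resPolynomial q).eval ε = (evalScalar ε q).res := by
  have h : ∀ (s : Finset ℕ) (f : ℕ → PsiDO n k), (∑ j ∈ s, f j).res = ∑ j ∈ s, (f j).res :=
    fun s f => map_sum (AddMonoidHom.mk' (res : PsiDO n k → k) res_add) f s
  rw [resPolynomial, Polynomial.eval_finsetSum, evalScalar_apply, h]
  refine Finset.sum_congr rfl fun j _ => ?_
  rw [Polynomial.eval_monomial, res_smul, mul_comm]

theorem eval_derivative_resPolynomial (q : Polynomial (PsiDO n k)) :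
    (resPolynomial q).derivative.eval 0 = (q.coeff 1).res := by
  rw [← Polynomial.coeff_zero_eq_eval_zero, Polynomial.coeff_derivative, resPolynomial,
    Polynomial.finsetSum_coeff]
  simp only [Polynomial.coeff_monomial]
  rw [zero_add, Finset.sum_ite_eq']
  split_ifs with h
  · simp
  · rw [Polynomial.coeff_eq_zero_of_natDegree_lt]
    · simp
    · simp only [Finset.mem_range] at h
      omega

theorem coeff_zero_pow_line (A B : PsiDO n k) (r : ℕ) :
    ((Polynomial.C A + Polynomial.C B * Polynomial.X) ^ r).coeff 0 = A ^ r := by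
  rw [← Polynomial.constantCoeff_apply, map_pow]
  simp

theorem res_mul_coeff_one_pow_line {A C : PsiDO n k} (B : PsiDO n k) (h : Commute C A) (r : ℕ) :
    (C * ((Polynomial.C A + Polynomial.C B * Polynomial.X) ^ r).coeff 1).res =
      r * (B * (A ^ (r - 1) * C)).res := by
  induction r generalizing C with
  | zero => simp [Polynomial.coeff_one]
  | succ r ih =>
    have h1 : (Polynomial.C A + Polynomial.C B * Polynomial.X).coeff 1 = B := by simp
    have h0 : (Polynomial.C A + Polynomial.C B * Polynomial.X).coeff 0 = A := by simp
    rw [pow_succ, Polynomial.mul_coeff_one, coeff_zero_pow_line, h1, h0, mul_add, res_add,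
      ← mul_assoc, res_mul_comm _ B, (h.pow_right r).eq, ← mul_assoc C, res_mul_comm _ A,
      ← mul_assoc A, ih ((Commute.refl A).mul_left h)]
    rcases r with _ | r
    · simp
    · rw [Nat.add_sub_cancel, Nat.add_sub_cancel, pow_succ A r]
      simp only [mul_assoc]
      push_cast
      ring

theorem nsmul_lie_eq (r : ℕ) (A B : PsiDO n k) : ⁅r • A, B⁆ = r • ⁅A, B⁆ := by
  rw [Ring.lie_def, Ring.lie_def, smul_sub, smul_mul_assoc, mul_smul_comm]

/-- The projection to `P₊` as a linear map. -/
def plusLinearMap : PsiDO n k →ₗ[k] PsiDO n k where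
  toFun := plus
  map_add' A B := by
    ext e
    simp only [plus, coeff_mk, coeff_add]
    split_ifs <;> simp
  map_smul' c A := by
    ext e
    simp only [plus, coeff_mk, coeff_smul, RingHom.id_apply]
    split_ifs <;> simp

theorem plus_nsmul (r : ℕ) (A : PsiDO n k) : (r • A).plus = r • A.plus :=
  map_nsmul plusLinearMap r A

/-- The `R`-bracket paired with an operator which commutes with the second argument. -/
theorem res_mul_rBracket [CharZero k] {L V : PsiDO n k} (U : PsiDO n k) (h : ⁅V, L⁆ = 0) :
    (L * U.rBracket V).res = (⁅V.plus, L⁆ * U).res := by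
  have h1 : (L * ⁅U.rMatrix, V⁆).res = 0 := by
    rw [res_mul_lie, h, mul_zero, res_zero]
  have h2 : (L * ⁅U, V.rMatrix⁆).res = 2 * (⁅V.plus, L⁆ * U).res := by
    have : ⁅V.rMatrix, L⁆ = ⁅V.plus, L⁆ + ⁅V.plus, L⁆ := by
      rw [Ring.lie_def, sub_eq_zero] at h
      simp only [rMatrix, minus, Ring.lie_def, sub_mul, mul_sub, h]
      abel
    rw [res_mul_lie, this, mul_add, res_add, res_mul_comm U]
    ring
  rw [rBracket, mul_add, mul_smul_comm, mul_smul_comm, res_add, res_smul, res_smul, h1, h2]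
  ring

end PsiDO

namespace PhaseSpace

variable {n : ℕ} {k : Type*} [Field k]

theorem commute_of_mem_commuting {L : PhaseSpace n k} (hL : L ∈ commuting n k) (i j : Fin n) :
    Commute (L i) (L j) :=
  commute_iff_lie_eq.2 (hL i j)

theorem commute_prod {L : PhaseSpace n k} {A : PsiDO n k} (h : ∀ i, Commute A (L i))
    (l : List (Fin n)) (m : Fin n → ℕ) : Commute A (l.map fun i => L i ^ m i).prod := by
  refine Commute.list_prod_right _ _ fun B hB => ?_
  obtain ⟨i, -, rfl⟩ := List.mem_map.1 hB
  exact (h i).pow_right _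

theorem res_mul_coeff_one_prod {L : PhaseSpace n k} (hL : L ∈ commuting n k) (M : PhaseSpace n k)
    (m : Fin n → ℕ) (l : List (Fin n)) (hl : l.Nodup) {A : PsiDO n k}
    (hA : ∀ i, Commute A (L i)) :
    (A * ((l.map fun i => (Polynomial.C (L i) + Polynomial.C (M i) * Polynomial.X) ^
        m i).prod).coeff 1).res =
      (l.map fun i => m i *
        (M i * ((l.map fun j => L j ^ Function.update m i (m i - 1) j).prod * A)).res).sum := by
  have hc := commute_of_mem_commuting hL
  induction l generalizing A with
  | nil => simp [Polynomial.coeff_one]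
  | cons i l ih =>
    obtain ⟨hi, hl⟩ := List.nodup_cons.1 hl
    have h0 : ((l.map fun i => (Polynomial.C (L i) + Polynomial.C (M i) * Polynomial.X) ^
        m i).prod).coeff 0 = (l.map fun i => L i ^ m i).prod := by
      rw [← Polynomial.constantCoeff_apply, map_list_prod, List.map_map]
      congr 1
      refine List.map_congr_left fun j _ => ?_
      exact PsiDO.coeff_zero_pow_line _ _ _
    have hA' : ∀ j, Commute (A * L i ^ m i) (L j) := fun j =>
      (hA j).mul_left ((hc i j).pow_left _)
    have hA'' : Commute ((l.map fun i => L i ^ m i).prod * A) (L i) :=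
      (commute_prod (hc i) l m).symm.mul_left (hA i)
    rw [List.map_cons, List.prod_cons, Polynomial.mul_coeff_one, PsiDO.coeff_zero_pow_line, h0,
      mul_add, PsiDO.res_add, ← mul_assoc, ih hl hA', ← mul_assoc A, PsiDO.res_mul_comm _ (_ : List _).prod,
      ← mul_assoc, PsiDO.res_mul_coeff_one_pow_line _ hA'', List.map_cons, List.sum_cons, add_comm]
    congr 1
    · rw [List.map_cons, List.prod_cons, Function.update_self, mul_assoc (L i ^ (m i - 1))]
      congr 6
      refine List.map_congr_left fun j hj => ?_
      rw [Function.update_of_ne (ne_of_mem_of_not_mem hj hi)]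
    · congr 1
      refine List.map_congr_left fun j hj => ?_
      rw [List.map_cons, List.prod_cons, Function.update_of_ne (ne_of_mem_of_not_mem hj hi).symm,
        mul_assoc (L i ^ m i), ((commute_prod (hc i) l _).mul_right (hA i).symm).pow_left _ |>.eq,
        mul_assoc]

theorem isGradient_hamiltonian {L : PhaseSpace n k} (hL : L ∈ commuting n k) (m : Fin n → ℕ) :
    IsGradient (hamiltonian m) L fun i => m i • L.monomial (Function.update m i (m i - 1)) := by
  intro M
  refine ⟨PsiDO.resPolynomial ((List.finRange n).map fun i =>
    (Polynomial.C (L i) + Polynomial.C (M i) * Polynomial.X) ^ m i).prod, fun ε => ?_, ?_⟩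
  · rw [PsiDO.eval_resPolynomial, map_list_prod, List.map_map, hamiltonian, monomial_eq_prod_map]
    congr 3
    funext i
    rw [Function.comp_apply, map_pow, PsiDO.evalScalar_line]
    rfl
  · rw [PsiDO.eval_derivative_resPolynomial]
    have := res_mul_coeff_one_prod hL M m _ (List.nodup_finRange n) (A := 1)
      fun i => Commute.one_left _
    rw [one_mul] at this
    rw [this, pairing, Fin.sum_univ_def]
    congr 1
    refine List.map_congr_left fun i _ => ?_
    rw [monomial_eq_prod_map, mul_one, ← Nat.cast_smul_eq_nsmul k, mul_smul_comm, PsiDO.res_smul]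

theorem lie_monomial {L : PhaseSpace n k} (hL : L ∈ commuting n k) (m : Fin n → ℕ) (i : Fin n) :
    ⁅L.monomial m, L i⁆ = 0 := by
  rw [← commute_iff_lie_eq, monomial_eq_prod_map]
  exact (commute_prod (commute_of_mem_commuting hL i) _ m).symm

/-- The velocity of the Hamiltonian flow of `H_m` on `P'`. -/
theorem poissonBracketR_hamiltonian [CharZero k] {L : PhaseSpace n k} (hL : L ∈ commuting n k)
    (m : Fin n → ℕ) (F : PhaseSpace n k → k) :
    poissonBracketR F (hamiltonian m) L =
      pairing (fun i => m i • ⁅(L.monomial (Function.update m i (m i - 1))).plus, L i⁆)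
        (gradient F L) := by
  rw [poissonBracketR, (isGradient_gradient (hamiltonian_mem_functionals m) L).unique
    (isGradient_hamiltonian hL m)]
  refine Finset.sum_congr rfl fun i _ => ?_
  rw [PsiDO.res_mul_rBracket, PsiDO.plus_nsmul, PsiDO.nsmul_lie_eq]
  rw [PsiDO.nsmul_lie_eq, lie_monomial hL, smul_zero]

end PhaseSpace

end

theorem proposition8 {k : Type*} [Field k] [CharZero k] {n : ℕ} (m : Fin n → ℕ) :
    PhaseSpace.hamiltonian m ∈ PhaseSpace.functionals n k ∧
    (∀ F ∈ PhaseSpace.functionals n k, ∀ L : PhaseSpace n k,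
      ∃! U : PhaseSpace n k, PhaseSpace.IsGradient F L U) ∧
    ∀ L ∈ PhaseSpace.commuting n k, ∀ X : PhaseSpace n k,
      PhaseSpace.IsHamiltonianVelocity (PhaseSpace.hamiltonian m) L X ↔
        ∀ i, X i = m i • ⁅(L.monomial (Function.update m i (m i - 1))).plus, L i⁆ := by
  refine ⟨PhaseSpace.hamiltonian_mem_functionals m,
    fun F hF L => PhaseSpace.existsUnique_isGradient hF L, fun L hL X => ?_⟩
  have hX : PhaseSpace.IsHamiltonianVelocity (PhaseSpace.hamiltonian m) L fun i =>
      m i • ⁅(L.monomial (Function.update m i (m i - 1))).plus, L i⁆ := by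
    intro F hF
    rw [PhaseSpace.poissonBracketR_hamiltonian hL]
    exact PhaseSpace.isGradient_gradient hF L _
  refine ⟨fun h i => ?_, fun h => ?_⟩
  · ext e
    have hF := PhaseSpace.coeff_mem_functionals (k := k) i e
    have key : ∀ Y : PhaseSpace n k, PhaseSpace.HasDirDeriv
        (fun L : PhaseSpace n k => (L i).coeff e) L Y ((Y i).coeff e) := by
      intro Y
      refine ⟨Polynomial.C ((L i).coeff e) + Polynomial.C ((Y i).coeff e) * Polynomial.X,
        fun ε => ?_, by simp⟩
      simp [mul_comm ε]
    exact ((key X).unique (h _ hF)).trans ((hX _ hF).unique (key _))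
  · rw [funext h]
    exact hX
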